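/- Fix a universe $\mathbb U$; schemes are $\mathbb U$-small and sheaves are sheaves of $\mathbb U$-small sets. "Coherent" means quasi-compact and quasi-separated. Let $f\colon Y\to X$ be a morphism of schemes. Let $E$ be the category whose objects are the morphisms of schemes $V\to U$ over $f$ (that is, $U$ is an $X$-scheme, $V$ is a $Y$-scheme, and the square formed by $V\to U\to X$ and $V\to Y\xrightarrow{f} X$ commutes) such that $U\to X$ is étale and $V\to U\times_XY$ is finite étale; a morphism $(V'\to U')\to(V\to U)$ is a pair consisting of a $Y$-morphism $V'\to V$ and an $X$-morphism $U'\to U$ compatible with $V'\to U'$ and $V\to U$. Equip $E$ with the topology generated by the families $\{(V_i\to U_i)\to(V\to U)\}_{i\in I}$ of the following two types: (v) $U_i=U$ for all $i\in I$, and $(V_i\to V)_{i\in I}$ is an étale covering; (c) $(U_i\to U)_{i\in I}$ is an étale covering, and $V_i=U_i\times_UV$ for all $i\in I$. Let $\widetilde E$ be the topos of sheaves of sets on $E$ (the Faltings topos of $f$), write $F^a$ for the sheaf associated with a presheaf $F$ on $E$, and let $E_{\rm coh}\subset E$ be the full subcategory of the objects $(V\to U)$ such that $U\to X$ is étale of finite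 presentation. In a topos, an object is quasi-compact if every epimorphic family over it has a finite epimorphic subfamily; a morphism $S\to Z$ is quasi-compact if $S\times_ZT$ is quasi-compact for every $T\to Z$ with $T$ quasi-compact; an object $Z$ is quasi-separated if every morphism $S\to Z$ with $S$ quasi-compact is quasi-compact. A topos is coherent if its final object is coherent and it has a generating family of coherent objects $Z$ whose diagonals $Z\to Z\times Z$ are quasi-compact. **Proposition.** Assume that $X$ and $Y$ are coherent. Then: (i) For every object $(V\to U)$ of $E_{\rm coh}$, the sheaf $(V\to U)^a$ associated with the presheaf represented by $(V\to U)$ is a coherent object of $\widetilde E$. (ii) The topos $\widetilde E$ is coherent; in particular, it has enough points. -/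

import Mathlib

open CategoryTheory CategoryTheory.Limits AlgebraicGeometry

universe u v w

/-! ### Coherence in a topos -/

namespace ToposCoherence

variable {T : Type w} [Category.{v} T]

/-- A family of morphisms with the same target is epimorphic if two morphisms out of the target
that agree on every member of the family are equal. In a topos these are exactly the covering
families for the canonical topology. -/
def IsEpimorphicFamily {X : T} {ι : Type*} (F : ι → T) (p : ∀ i, F i ⟶ X) : Prop :=
  ∀ ⦃Z : T⦄ (a b : X ⟶ Z), (∀ i, p i ≫ a = p i ≫ b) → a = b

/-- An object of a topos is quasi-compact if every epimorphic family over it has a finite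
epimorphic subfamily. (The index types are large enough to index all morphisms to `X`.) -/
def IsQuasiCompactObj (X : T) : Prop :=
  ∀ (ι : Type (max w v)) (F : ι → T) (p : ∀ i, F i ⟶ X), IsEpimorphicFamily F p →
    ∃ s : Finset ι, IsEpimorphicFamily (fun i : s ↦ F i) (fun i : s ↦ p i)

/-- A morphism `f : X ⟶ Y` is quasi-compact if its base change along any morphism with
quasi-compact source has quasi-compact source. -/
def IsQuasiCompactHom [HasPullbacks T] {X Y : T} (f : X ⟶ Y) : Prop :=
  ∀ (S : T) (g : S ⟶ Y), IsQuasiCompactObj S → IsQuasiCompactObj (pullback f g)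

/-- An object is quasi-separated if every morphism to it from a quasi-compact object is
quasi-compact, i.e. `S ×_X S'` is quasi-compact for all quasi-compact `S`, `S'` over `X`. -/
def IsQuasiSeparatedObj [HasPullbacks T] (X : T) : Prop :=
  ∀ (S : T) (g : S ⟶ X), IsQuasiCompactObj S → IsQuasiCompactHom g

/-- An object is coherent if it is quasi-compact and quasi-separated. -/
def IsCoherentObj [HasPullbacks T] (X : T) : Prop :=
  IsQuasiCompactObj X ∧ IsQuasiSeparatedObj X

/-- A topos is algebraic if it has a generating family of coherent objects each of which is
quasi-separated over the final object, i.e. has a quasi-compact diagonal `X ⟶ X ⨯ X`. -/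
def IsAlgebraicTopos (T : Type w) [Category.{v} T] [HasFiniteLimits T] : Prop :=
  ∃ P : ObjectProperty T, P.IsSeparating ∧
    ∀ X : T, P X → IsCoherentObj X ∧ IsQuasiCompactHom (diag X)

/-- A topos is coherent if it is algebraic and its final object is coherent. -/
def IsCoherentTopos (T : Type w) [Category.{v} T] [HasFiniteLimits T] : Prop :=
  IsAlgebraicTopos T ∧ IsCoherentObj (⊤_ T)

end ToposCoherence

/-! ### The Faltings site of a morphism of schemes -/

/-- An object `(V ⟶ U)` of the category `E` attached to `f : Y ⟶ X`: a morphism of schemes over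
`f` such that `U ⟶ X` is étale and `V ⟶ U ×_X Y` is finite étale. -/
structure FaltingsObj {X Y : Scheme.{u}} (f : Y ⟶ X) where
  /-- the source, a scheme over `Y` -/
  V : Scheme.{u}
  /-- the target, a scheme over `X` -/
  U : Scheme.{u}
  /-- the morphism `V ⟶ U` -/
  hom : V ⟶ U
  /-- the structural morphism of `V` -/
  toY : V ⟶ Y
  /-- the structural morphism of `U` -/
  toX : U ⟶ X
  w : hom ≫ toX = toY ≫ f
  etale_toX : Etale toX
  finite_lift : IsFinite (pullback.lift hom toY w : V ⟶ pullback toX f)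
  etale_lift : Etale (pullback.lift hom toY w : V ⟶ pullback toX f)

namespace FaltingsObj

variable {X Y : Scheme.{u}} {f : Y ⟶ X}

/-- A morphism `(V' ⟶ U') ⟶ (V ⟶ U)` of `E`: a `Y`-morphism `V' ⟶ V` and an `X`-morphism
`U' ⟶ U` making the square commute. -/
@[ext]
structure Hom (A B : FaltingsObj f) where
  /-- the component `V' ⟶ V` -/
  left : A.V ⟶ B.V
  /-- the component `U' ⟶ U` -/
  right : A.U ⟶ B.U
  left_toY : left ≫ B.toY = A.toY
  right_toX : right ≫ B.toX = A.toX
  comm : left ≫ B.hom = A.hom ≫ right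

instance : Category.{u} (FaltingsObj f) where
  Hom := Hom
  id A := ⟨𝟙 _, 𝟙 _, by simp, by simp, by simp⟩
  comp {A B C} a b := ⟨a.left ≫ b.left, a.right ≫ b.right,
    by simp [a.left_toY, b.left_toY], by simp [a.right_toX, b.right_toX],
    by rw [Category.assoc, b.comm, ← Category.assoc, a.comm, Category.assoc]⟩
  id_comp _ := Hom.ext (Category.id_comp _) (Category.id_comp _)
  comp_id _ := Hom.ext (Category.comp_id _) (Category.comp_id _)
  assoc _ _ _ := Hom.ext (Category.assoc _ _ _) (Category.assoc _ _ _)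

/-- The objects of the full subcategory `E_coh`: those `(V ⟶ U)` for which the étale morphism
`U ⟶ X` is of finite presentation. -/
def IsCoh (A : FaltingsObj f) : Prop :=
  LocallyOfFinitePresentation A.toX ∧ QuasiCompact A.toX ∧ QuasiSeparated A.toX

/-- A vertical covering: `U_i = U` for all `i` (up to isomorphism) and `(V_i ⟶ V)` is an étale
covering. -/
def IsVerticalCover (A : FaltingsObj f) {ι : Type u} (B : ι → FaltingsObj f)
    (g : ∀ i, B i ⟶ A) : Prop :=
  (∀ i, IsIso (g i).right) ∧
    Presieve.ofArrows (fun i ↦ (B i).V) (fun i ↦ (g i).left) ∈ Scheme.etalePrecoverage A.V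

/-- A cartesian covering: `(U_i ⟶ U)` is an étale covering and `V_i = U_i ×_U V` for all `i`. -/
def IsCartesianCover (A : FaltingsObj f) {ι : Type u} (B : ι → FaltingsObj f)
    (g : ∀ i, B i ⟶ A) : Prop :=
  Presieve.ofArrows (fun i ↦ (B i).U) (fun i ↦ (g i).right) ∈ Scheme.etalePrecoverage A.U ∧
    ∀ i, IsPullback (g i).left (B i).hom A.hom (g i).right

end FaltingsObj

/-- The vertical and cartesian coverings of the category `E` attached to `f`. -/
def faltingsPrecoverage {X Y : Scheme.{u}} (f : Y ⟶ X) : Precoverage (FaltingsObj f) where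
  coverings A := {R | ∃ (ι : Type u) (B : ι → FaltingsObj f) (g : ∀ i, B i ⟶ A),
    R = Presieve.ofArrows B g ∧ (A.IsVerticalCover B g ∨ A.IsCartesianCover B g)}

/-- The co-evanescent topology on `E`: the coarsest Grothendieck topology for which the vertical
and the cartesian coverings are covering families. -/
def faltingsTopology {X Y : Scheme.{u}} (f : Y ⟶ X) : GrothendieckTopology (FaltingsObj f) :=
  (faltingsPrecoverage f).toGrothendieck

/-- The Faltings topos of `f : Y ⟶ X`: sheaves of (`u`-small) sets on the Faltings site. -/
abbrev FaltingsTopos {X Y : Scheme.{u}} (f : Y ⟶ X) :=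
  Sheaf (faltingsTopology f) (Type u)

/-! The objects of `E_coh` play the role of the quasi-compact opens of a coherent space: they cover
every object of `E`, they include the terminal object, they are stable under fibre products, and
every covering of one of them has a finite refinement among them (`IsCoherentBasis`). Fibre products
in `E` are formed componentwise (`isPullback_fiberProd`). Finiteness need only be checked on
pullbacks of the two generating types of coverings to objects of `E_coh`, where it holds because
étale morphisms are open and `U` and `V` are quasi-compact. An induction carries it to the generated
topology (`Precoverage.hasFiniteRefinement_of_mem`).

On any site with such a basis and a good sheafification, a sheaf of sets is quasi-compact exactly
when finitely many sections over basis objects generate it locally, and it is quasi-separated once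
the fibre products of any two such sections are finitely generated. Both conditions hold for
sheafified basis objects. Left exactness of sheafification extends them to the final sheaf and gives
the second one for the products `A^a × A^a`. This yields coherence of the objects and of the topos.

Enough points is Deligne's theorem, which needs a small site. `E_coh` is essentially small because a
quasi-compact quasi-separated scheme locally of finite type over a base is the coequalizer of two
morphisms between affine ones. Restriction to a small model of `E_coh` does not change the topos,
and this also provides sheafification on the large site `E`. For a non-covering sieve `S` on `X`, a
point is built that has an element over `X` not lifting along `S`. Starting from `Hom(X, -)`, the
functor is enlarged by an ultraproduct of representables so that all its old elements lift along all
coverings; the colimit of countably many such steps is the point. -/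

open Opposite

/-! ### Coherent bases of a site. -/

namespace CategoryTheory.GrothendieckTopology

/-- A class `P` of objects of a site is a coherent basis if every object is covered by objects of
`P`, every covering of an object of `P` has a finite refinement by objects of `P`, and `P` contains
a terminal object and is closed under fibre products. -/
structure IsCoherentBasis {C : Type w} [Category.{v} C] (J : GrothendieckTopology C)
    (P : ObjectProperty C) : Prop where
  dense (A : C) : ∃ S ∈ J A, ∀ ⦃V : C⦄ (f : V ⟶ A), S f →
    ∃ (B : C) (_ : P B) (h : V ⟶ B) (g : B ⟶ A), h ≫ g = f
  finite ⦃B : C⦄ (hB : P B) (S : Sieve B) (hS : S ∈ J B) :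
    ∃ (n : ℕ) (Z : Fin n → C) (g : ∀ i, Z i ⟶ B),
      (∀ i, P (Z i)) ∧ (∀ i, S (g i)) ∧ Sieve.ofArrows Z g ∈ J B
  pullback ⦃A B D : C⦄ (hA : P A) (hB : P B) (hD : P D) (f : A ⟶ D) (g : B ⟶ D) :
    ∃ (W : C) (p : W ⟶ A) (q : W ⟶ B), P W ∧ IsPullback p q f g
  terminal : ∃ (T : C) (_ : IsTerminal T), P T

lemma mem_of_locally_mem {C : Type w} [Category.{v} C] (J : GrothendieckTopology C) {U : C}
    {S : Sieve U} (hS : S ∈ J U) (Q : Sieve U)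
    (h : ∀ ⦃V : C⦄ (f : V ⟶ U), S f → ∃ S' ∈ J V, ∀ ⦃W : C⦄ (g : W ⟶ V), S' g → Q (g ≫ f)) :
    Q ∈ J U :=
  J.transitive hS _ fun V f hf ↦ by
    obtain ⟨S', hS', h'⟩ := h f hf
    exact J.superset_covering (fun W g hg ↦ h' g hg) hS'

end CategoryTheory.GrothendieckTopology

/-! ### Quasi-compact and quasi-separated sheaves in terms of a coherent basis. -/

namespace ToposCoherence

section Invariance

variable {T : Type w} [Category.{v} T]

lemma IsEpimorphicFamily.comp_isIso {X Y : T} {ι : Type*} {F : ι → T} {p : ∀ i, F i ⟶ X}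
    (h : IsEpimorphicFamily F p) (e : X ⟶ Y) [IsIso e] :
    IsEpimorphicFamily F fun i ↦ p i ≫ e := fun Z a b hab ↦ by
  rw [← cancel_epi e]
  exact h _ _ fun i ↦ by simpa using hab i

lemma IsQuasiCompactObj.of_iso {X Y : T} (h : IsQuasiCompactObj X) (e : X ≅ Y) :
    IsQuasiCompactObj Y := fun ι F p hp ↦ by
  obtain ⟨s, hs⟩ := h ι F (fun i ↦ p i ≫ e.inv) (hp.comp_isIso e.inv)
  refine ⟨s, ?_⟩
  simpa using hs.comp_isIso e.hom

end Invariance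

section Sheaf

variable {C : Type (u + 1)} [Category.{u} C] {J : GrothendieckTopology C}

lemma map_op_comp_apply (X : Cᵒᵖ ⥤ Type u) {U V W : C} (f : W ⟶ V) (g : V ⟶ U)
    (x : X.obj (op U)) : X.map (f ≫ g).op x = X.map f.op (X.map g.op x) := by
  simp

/-- The sections that lift locally form a subsheaf of `X` through which the whole family factors.
Its inclusion is therefore both mono and epi, and sheaves of sets form a balanced category. -/
lemma IsEpimorphicFamily.exists_locally [HasSheafify J (Type u)]
    {X : Sheaf J (Type u)} {ι : Type*}
    {F : ι → Sheaf J (Type u)} {p : ∀ i, F i ⟶ X} (hp : IsEpimorphicFamily F p)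
    {U : C} (y : X.obj.obj (op U)) :
    ∃ S ∈ J U, ∀ ⦃V : C⦄ (f : V ⟶ U), S f →
      ∃ (i : ι) (t : (F i).obj.obj (op V)), (p i).hom.app _ t = X.obj.map f.op y := by
  let R : Subfunctor X.obj :=
    { obj U := {y | ∃ (i : ι) (t : (F i).obj.obj U), (p i).hom.app _ t = y}
      map := by
        rintro U V f _ ⟨i, t, rfl⟩
        exact ⟨i, (F i).obj.map f t, NatTrans.naturality_apply (p i).hom f t⟩ }
  have hX : Presieve.IsSheaf J X.obj := (isSheaf_iff_isSheaf_of_type _ _).1 X.property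
  let G : Sheaf J (Type u) :=
    ⟨(R.sheafify J).toFunctor,
      (isSheaf_iff_isSheaf_of_type _ _).2 (R.sheafify_isSheaf hX)⟩
  let j : G ⟶ X := ⟨(R.sheafify J).ι⟩
  have : Mono j := by
    have : Mono j.hom := inferInstanceAs (Mono (R.sheafify J).ι)
    exact Sheaf.Hom.mono_of_presheaf_mono _ _ j
  have : Epi j := ⟨fun {Z} a b hab ↦ hp a b fun i ↦ by
    ext V t
    exact ConcreteCategory.congr_hom (NatTrans.congr_app (congrArg (·.hom) hab) V)
      ⟨(p i).hom.app V t, R.le_sheafify J V ⟨i, t, rfl⟩⟩⟩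
  have : IsIso j := isIso_of_mono_of_epi j
  have hbij : Function.Bijective (j.hom.app (op U)) := by
    rw [← isIso_iff_bijective]
    have : IsIso j.hom := inferInstanceAs (IsIso ((sheafToPresheaf J (Type u)).map j))
    infer_instance
  obtain ⟨⟨y, hy⟩, rfl⟩ := hbij.2 y
  exact ⟨_, hy, fun V f hf ↦ hf⟩

lemma IsEpimorphicFamily.of_exists_locally {X : Sheaf J (Type u)} {ι : Type*}
    {F : ι → Sheaf J (Type u)} {p : ∀ i, F i ⟶ X}
    (hp : ∀ {U : C} (y : X.obj.obj (op U)), ∃ S ∈ J U, ∀ ⦃V : C⦄ (f : V ⟶ U), S f →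
      ∃ (i : ι) (t : (F i).obj.obj (op V)), (p i).hom.app _ t = X.obj.map f.op y) :
    IsEpimorphicFamily F p := fun Z a b hab ↦ by
  ext ⟨U⟩ y
  obtain ⟨S, hS, h⟩ := hp y
  apply (((isSheaf_iff_isSheaf_of_type _ _).1 Z.property).isSeparated _ hS).ext
  intro V f hf
  obtain ⟨i, t, ht⟩ := h f hf
  have h₁ := NatTrans.naturality_apply a.hom f.op y
  have h₂ := NatTrans.naturality_apply b.hom f.op y
  change Z.obj.map f.op (a.hom.app _ y) = Z.obj.map f.op (b.hom.app _ y)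
  rw [← h₁, ← h₂, ← ht]
  exact ConcreteCategory.congr_hom (NatTrans.congr_app (congrArg (·.hom) (hab i)) (op V)) t

/-- A presheaf is finitely generated (by `P`) if it has finitely many sections over objects of
`P` such that every section is locally a restriction of one of these. -/
def IsFinitelyGenerated (J : GrothendieckTopology C) (P : ObjectProperty C)
    (X : Cᵒᵖ ⥤ Type u) : Prop :=
  ∃ (n : ℕ) (A : Fin n → C) (x : ∀ i, X.obj (op (A i))), (∀ i, P (A i)) ∧
    ∀ {U : C} (y : X.obj (op U)), ∃ S ∈ J U, ∀ ⦃V : C⦄ (f : V ⟶ U), S f →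
      ∃ (i : _) (h : V ⟶ A i), X.map f.op y = X.map h.op (x i)

variable {P : ObjectProperty C}

lemma IsFinitelyGenerated.of_finite {X : Cᵒᵖ ⥤ Type u} {ι : Type*} [Finite ι] (A : ι → C)
    (x : ∀ i, X.obj (op (A i))) (hA : ∀ i, P (A i))
    (h : ∀ {U : C} (y : X.obj (op U)), ∃ S ∈ J U, ∀ ⦃V : C⦄ (f : V ⟶ U), S f →
      ∃ (i : ι) (h : V ⟶ A i), X.map f.op y = X.map h.op (x i)) :
    IsFinitelyGenerated J P X := by
  obtain ⟨n, ⟨e⟩⟩ := Finite.exists_equiv_fin ι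
  refine ⟨n, A ∘ e.symm, fun i ↦ x _, fun i ↦ hA _, fun y ↦ ?_⟩
  obtain ⟨S, hS, hy⟩ := h y
  refine ⟨S, hS, fun V f hf ↦ ?_⟩
  obtain ⟨i, h, hi⟩ := hy f hf
  obtain ⟨i, rfl⟩ := e.symm.surjective i
  exact ⟨i, h, hi⟩

variable [HasSheafify J (Type u)]

/-- Each generating section lifts to the family on some covering, which has a finite refinement. The
finitely many indices met in this way already give an epimorphic subfamily. -/
lemma isQuasiCompactObj_of_isFinitelyGenerated (hP : J.IsCoherentBasis P)
    {X : Sheaf J (Type u)} (hX : IsFinitelyGenerated J P X.obj) : IsQuasiCompactObj X := by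
  classical
  intro ι F p hp
  obtain ⟨n, A, x, hA, hx⟩ := hX
  choose S hS hS' using fun k ↦ hp.exists_locally (x k)
  choose m Z g _ hg hcov using fun k ↦ hP.finite (hA k) (S k) (hS k)
  choose i t hit using fun k l ↦ hS' k (g k l) (hg k l)
  refine ⟨Finset.univ.biUnion fun k ↦ Finset.univ.image (i k), .of_exists_locally fun {U} y ↦ ?_⟩
  obtain ⟨S₀, hS₀, h₀⟩ := hx y
  let Q : Sieve U :=
    { arrows V f := ∃ (j : _) (_ : j ∈ Finset.univ.biUnion fun k ↦ Finset.univ.image (i k))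
        (t : (F j).obj.obj (op V)), (p j).hom.app _ t = X.obj.map f.op y
      downward_closed := by
        rintro V W f ⟨j, hj, t, ht⟩ q
        refine ⟨j, hj, (F j).obj.map q.op t, ?_⟩
        rw [NatTrans.naturality_apply, ht]
        simp }
  refine ⟨Q, J.mem_of_locally_mem hS₀ Q fun V f hf ↦ ?_, ?_⟩
  · obtain ⟨k, h, hk⟩ := h₀ f hf
    refine ⟨_, J.pullback_stable h (hcov k), ?_⟩
    rintro W q hq
    obtain ⟨_, r, _, ⟨l⟩, e⟩ := hq
    refine ⟨i k l, Finset.mem_biUnion.2 ⟨k, Finset.mem_univ _,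
      Finset.mem_image.2 ⟨l, Finset.mem_univ _, rfl⟩⟩, (F (i k l)).obj.map r.op (t k l), ?_⟩
    rw [NatTrans.naturality_apply, hit, ← comp_apply, ← Functor.map_comp, ← op_comp, e]
    simp [hk]
  · rintro V f ⟨j, hj, t, ht⟩
    exact ⟨⟨j, hj⟩, t, ht⟩

/-- The morphism from the sheaf associated to a representable presheaf given by a section. -/
noncomputable def ofSection {A : C} (X : Sheaf J (Type u)) (x : X.obj.obj (op A)) :
    (presheafToSheaf J (Type u)).obj (yoneda.obj A) ⟶ X :=
  ⟨sheafifyLift J (yonedaEquiv.symm x) X.property⟩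

lemma ofSection_toSheafify {A V : C} (X : Sheaf J (Type u)) (x : X.obj.obj (op A)) (h : V ⟶ A) :
    (ofSection X x).hom.app (op V) ((toSheafify J (yoneda.obj A)).app (op V) h) =
      X.obj.map h.op x := by
  have := ConcreteCategory.congr_hom (NatTrans.congr_app
    (toSheafify_sheafifyLift J (yonedaEquiv.symm x) X.property) (op V)) h
  exact this.trans (by simp [yonedaEquiv])

section

variable [J.WEqualsLocallyBijective (Type u)]

lemma exists_eq_toSheafify {A U : C}
    (t : ((presheafToSheaf J (Type u)).obj (yoneda.obj A)).obj.obj (op U)) :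
    ∃ S ∈ J U, ∀ ⦃V : C⦄ (f : V ⟶ U), S f → ∃ h : V ⟶ A,
      (toSheafify J (yoneda.obj A)).app (op V) h =
        ((presheafToSheaf J (Type u)).obj (yoneda.obj A)).obj.map f.op t :=
  ⟨_, Presheaf.imageSieve_mem J (toSheafify J (yoneda.obj A)) t, fun _ _ ⟨h, hh⟩ ↦ ⟨h, hh⟩⟩

lemma exists_eq_of_toSheafify_eq {A U : C} {a b : U ⟶ A}
    (h : (toSheafify J (yoneda.obj A)).app (op U) a =
      (toSheafify J (yoneda.obj A)).app (op U) b) :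
    ∃ S ∈ J U, ∀ ⦃V : C⦄ (f : V ⟶ U), S f → f ≫ a = f ≫ b :=
  ⟨_, Presheaf.equalizerSieve_mem J (toSheafify J (yoneda.obj A)) a b h,
    fun _ _ h ↦ by simpa [Presheaf.equalizerSieve] using h⟩

omit [J.WEqualsLocallyBijective (Type u)] in
lemma toSheafify_map {A V W : C} (f : W ⟶ V) (h : V ⟶ A) :
    (toSheafify J (yoneda.obj A)).app (op W) (f ≫ h) =
      ((presheafToSheaf J (Type u)).obj (yoneda.obj A)).obj.map f.op
        ((toSheafify J (yoneda.obj A)).app (op V) h) :=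
  NatTrans.naturality_apply (toSheafify J (yoneda.obj A)) f.op h

/-- By density, all sections over basis objects together form an epimorphic family of morphisms from
sheafified representables; a finite subfamily gives the generators. -/
lemma IsQuasiCompactObj.isFinitelyGenerated (hP : J.IsCoherentBasis P)
    {X : Sheaf J (Type u)} (hX : IsQuasiCompactObj X) : IsFinitelyGenerated J P X.obj := by
  let ι := {a : Σ A : C, X.obj.obj (op A) // P a.1}
  obtain ⟨s, hs⟩ := hX ι (fun a ↦ (presheafToSheaf J (Type u)).obj (yoneda.obj a.1.1))
    (fun a ↦ ofSection X a.1.2) (.of_exists_locally fun {U} y ↦ by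
      obtain ⟨S, hS, h⟩ := hP.dense U
      refine ⟨S, hS, fun V f hf ↦ ?_⟩
      obtain ⟨B, hB, h, g, rfl⟩ := h f hf
      refine ⟨⟨⟨B, X.obj.map g.op y⟩, hB⟩, (toSheafify J (yoneda.obj B)).app (op V) h, ?_⟩
      rw [ofSection_toSheafify]
      simp)
  refine .of_finite (ι := s) (fun a ↦ a.1.1.1) (fun a ↦ a.1.1.2) (fun a ↦ a.1.2) fun {U} y ↦ ?_
  obtain ⟨S, hS, h⟩ := hs.exists_locally y
  let Q : Sieve U :=
    { arrows V f := ∃ (i : s) (h : V ⟶ i.1.1.1), X.obj.map f.op y = X.obj.map h.op i.1.1.2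
      downward_closed := by
        rintro V W f ⟨i, h, hi⟩ q
        exact ⟨i, q ≫ h, by simp [hi]⟩ }
  refine ⟨Q, J.mem_of_locally_mem hS Q fun V f hf ↦ ?_, fun V f h ↦ h⟩
  obtain ⟨i, t, ht⟩ := h f hf
  obtain ⟨S', hS', h'⟩ := exists_eq_toSheafify t
  refine ⟨S', hS', fun W g hg ↦ ?_⟩
  obtain ⟨k, hk⟩ := h' g hg
  refine ⟨i, k, ?_⟩
  rw [← ofSection_toSheafify X i.1.1.2 k, hk, NatTrans.naturality_apply, ht]
  simp

/-- A presheaf is finitely separated (relatively to `P`) if the fibre products over it of any two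
sections over objects of `P` are finitely generated. -/
def IsFinitelySeparated (J : GrothendieckTopology C) (P : ObjectProperty C)
    (X : Cᵒᵖ ⥤ Type u) : Prop :=
  ∀ ⦃B B' : C⦄ (_ : P B) (_ : P B') (x : X.obj (op B)) (x' : X.obj (op B')),
    ∃ (ι : Type) (_ : Finite ι) (W : ι → C) (q : ∀ i, W i ⟶ B) (q' : ∀ i, W i ⟶ B'),
      (∀ i, P (W i)) ∧ (∀ i, X.map (q i).op x = X.map (q' i).op x') ∧
      ∀ ⦃U : C⦄ (g : U ⟶ B) (g' : U ⟶ B'), X.map g.op x = X.map g'.op x' →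
        ∃ S ∈ J U, ∀ ⦃V : C⦄ (f : V ⟶ U), S f →
          ∃ (i : ι) (h : V ⟶ W i), h ≫ q i = f ≫ g ∧ h ≫ q' i = f ≫ g'

omit [HasSheafify J (Type u)] [J.WEqualsLocallyBijective (Type u)] in
lemma IsFinitelySeparated.of_iso {X Y : Cᵒᵖ ⥤ Type u} (hY : IsFinitelySeparated J P Y)
    (e : X ≅ Y) : IsFinitelySeparated J P X := by
  have key {B B' U : C} (x : X.obj (op B)) (x' : X.obj (op B')) (g : U ⟶ B) (g' : U ⟶ B') :
      X.map g.op x = X.map g'.op x' ↔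
        Y.map g.op (e.hom.app _ x) = Y.map g'.op (e.hom.app _ x') := by
    rw [← NatTrans.naturality_apply, ← NatTrans.naturality_apply]
    exact ((e.app (op U)).toEquiv.injective.eq_iff).symm
  intro B B' hB hB' x x'
  obtain ⟨ι, hι, W, q, q', h₁, h₂, h₃⟩ := hY hB hB' (e.hom.app _ x) (e.hom.app _ x')
  exact ⟨ι, hι, W, q, q', h₁, fun i ↦ (key _ _ _ _).2 (h₂ i),
    fun U g g' h ↦ h₃ g g' ((key _ _ _ _).1 h)⟩

/-- If `s k` and `s' k'` generate `S` and `S'`, then `S ×_X S'` is generated by the generators of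
the fibre products over `X` of their images. -/
lemma isQuasiSeparatedObj_of_isFinitelySeparated (hP : J.IsCoherentBasis P)
    {X : Sheaf J (Type u)} (hX : IsFinitelySeparated J P X.obj) : IsQuasiSeparatedObj X := by
  intro S g hS S' g' hS'
  obtain ⟨n, A, s, hA, hs⟩ := hS.isFinitelyGenerated hP
  obtain ⟨n', A', s', hA', hs'⟩ := hS'.isFinitelyGenerated hP
  apply isQuasiCompactObj_of_isFinitelyGenerated hP
  -- Pullbacks of sheaves are computed sectionwise.
  have sq (U : C) := (IsPullback.of_hasPullback g g').map
    (sheafToPresheaf J (Type u) ⋙ (evaluation _ _).obj (op U))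
  choose ι hι W q q' hW hq hcov using fun k k' ↦ hX (hA k) (hA' k')
    (g.hom.app _ (s k)) (g'.hom.app _ (s' k'))
  have hz (k k') (i : ι k k') : ∃ z : (pullback g g').obj.obj (op (W k k' i)),
      (pullback.fst g g').hom.app _ z = S.obj.map (q k k' i).op (s k) ∧
      (pullback.snd g g').hom.app _ z = S'.obj.map (q' k k' i).op (s' k') := by
    apply Types.exists_of_isPullback (sq (W k k' i))
    have := hq k k' i
    rw [← NatTrans.naturality_apply, ← NatTrans.naturality_apply] at this
    exact this
  choose z hz₁ hz₂ using hz
  refine .of_finite (ι := Σ (k : Fin n) (k' : Fin n'), ι k k')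
    (fun i ↦ W i.1 i.2.1 i.2.2) (fun i ↦ z _ _ i.2.2) (fun i ↦ hW _ _ _) fun {U} y ↦ ?_
  obtain ⟨R, hR, h⟩ := hs ((pullback.fst g g').hom.app _ y)
  obtain ⟨R', hR', h'⟩ := hs' ((pullback.snd g g').hom.app _ y)
  let Q : Sieve U :=
    { arrows V f := ∃ (i : Σ (k : Fin n) (k' : Fin n'), ι k k') (h : V ⟶ W i.1 i.2.1 i.2.2),
        (pullback g g').obj.map f.op y = (pullback g g').obj.map h.op (z _ _ i.2.2)
      downward_closed := by
        rintro V W f ⟨i, h, hi⟩ q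
        exact ⟨i, q ≫ h, by simp [hi]⟩ }
  refine ⟨Q, J.mem_of_locally_mem (J.intersection_covering hR hR') Q fun V f hf ↦ ?_,
    fun V f h ↦ h⟩
  obtain ⟨k, a, ha⟩ := h f hf.1
  obtain ⟨k', a', ha'⟩ := h' f hf.2
  obtain ⟨S₀, hS₀, h₀⟩ := hcov k k' a a' (by
    rw [← NatTrans.naturality_apply, ← NatTrans.naturality_apply, ← ha, ← ha',
      NatTrans.naturality_apply, NatTrans.naturality_apply]
    congr 1
    exact ConcreteCategory.congr_hom
      (NatTrans.congr_app (congrArg (·.hom) (pullback.condition (f := g) (g := g'))) (op U)) y)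
  refine ⟨S₀, hS₀, fun V' f' hf' ↦ ?_⟩
  obtain ⟨i, b, hb, hb'⟩ := h₀ f' hf'
  refine ⟨⟨k, k', i⟩, b, Types.ext_of_isPullback (sq V') ?_ ?_⟩
  · change (pullback.fst g g').hom.app _ _ = (pullback.fst g g').hom.app _ _
    rw [NatTrans.naturality_apply, NatTrans.naturality_apply, hz₁, map_op_comp_apply, ha,
      ← map_op_comp_apply, ← hb, map_op_comp_apply]
  · change (pullback.snd g g').hom.app _ _ = (pullback.snd g g').hom.app _ _
    rw [NatTrans.naturality_apply, NatTrans.naturality_apply, hz₂, map_op_comp_apply, ha',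
      ← map_op_comp_apply, ← hb', map_op_comp_apply]

lemma isFinitelyGenerated_sheafify_yoneda {A : C} (hA : P A) :
    IsFinitelyGenerated J P ((presheafToSheaf J (Type u)).obj (yoneda.obj A)).obj := by
  refine .of_finite (ι := Unit) (fun _ ↦ A)
    (fun _ ↦ (toSheafify J (yoneda.obj A)).app (op A) (𝟙 A)) (fun _ ↦ hA) fun t ↦ ?_
  obtain ⟨S, hS, h⟩ := exists_eq_toSheafify t
  refine ⟨S, hS, fun V f hf ↦ ?_⟩
  obtain ⟨k, hk⟩ := h f hf
  exact ⟨⟨⟩, k, by rw [← hk, ← toSheafify_map, Category.comp_id]⟩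

/-- Sections of the sheafification are only locally morphisms to `A`. Over finite refinements `Z i`
and `Z' j` on which they are, the fibre products `Z i ×_A Z' j` in the site provide the generators.
-/
lemma isFinitelySeparated_sheafify_yoneda (hP : J.IsCoherentBasis P) {A : C} (hA : P A) :
    IsFinitelySeparated J P ((presheafToSheaf J (Type u)).obj (yoneda.obj A)).obj := by
  intro B B' hB hB'
  set X := ((presheafToSheaf J (Type u)).obj (yoneda.obj A)).obj with hX
  intro x x'
  obtain ⟨S, hS, h⟩ := exists_eq_toSheafify x
  obtain ⟨S', hS', h'⟩ := exists_eq_toSheafify x'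
  obtain ⟨n, Z, g, hZ, hg, hcov⟩ := hP.finite hB S hS
  obtain ⟨n', Z', g', hZ', hg', hcov'⟩ := hP.finite hB' S' hS'
  choose k hk using fun i ↦ h (g i) (hg i)
  choose k' hk' using fun i ↦ h' (g' i) (hg' i)
  choose W p p' hW sq using fun i j ↦ hP.pullback (hZ i) (hZ' j) hA (k i) (k' j)
  refine ⟨Fin n × Fin n', inferInstance, fun i ↦ W i.1 i.2, fun i ↦ p i.1 i.2 ≫ g i.1,
    fun i ↦ p' i.1 i.2 ≫ g' i.2, fun i ↦ hW _ _, fun i ↦ ?_, fun U a a' ha ↦ ?_⟩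
  · have := congrArg ((toSheafify J (yoneda.obj A)).app (op (W i.1 i.2))) (sq i.1 i.2).w
    rw [toSheafify_map, toSheafify_map, hk, hk'] at this
    simpa [X] using this
  · let Q : Sieve U :=
      { arrows V f := ∃ (i : Fin n × Fin n') (h : V ⟶ W i.1 i.2),
          h ≫ p i.1 i.2 ≫ g i.1 = f ≫ a ∧ h ≫ p' i.1 i.2 ≫ g' i.2 = f ≫ a'
        downward_closed := by
          rintro V W f ⟨i, h, h₁, h₂⟩ q
          exact ⟨i, q ≫ h, by simp [h₁], by simp [h₂]⟩ }
    refine ⟨Q, J.mem_of_locally_mem (J.intersection_covering (J.pullback_stable a hcov)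
      (J.pullback_stable a' hcov')) Q ?_, fun V f h ↦ h⟩
    rintro V f ⟨⟨_, r, _, ⟨i⟩, e⟩, ⟨_, r', _, ⟨i'⟩, e'⟩⟩
    -- Two morphisms to `A` with the same image in the sheafification agree only after a further
    -- covering.
    obtain ⟨S₀, hS₀, h₀⟩ := exists_eq_of_toSheafify_eq (J := J) (a := r ≫ k i) (b := r' ≫ k' i') (by
      rw [toSheafify_map, toSheafify_map, hk, hk']
      change X.map r.op (X.map (g i).op x) = X.map r'.op (X.map (g' i').op x')
      rw [← map_op_comp_apply, ← map_op_comp_apply, e, e', map_op_comp_apply,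
        map_op_comp_apply, ha])
    refine ⟨S₀, hS₀, fun V' f' hf' ↦ ⟨⟨i, i'⟩,
      (sq i i').lift (f' ≫ r) (f' ≫ r') (by simpa using h₀ f' hf'), ?_, ?_⟩⟩
    · simp [e]
    · simp [e']

lemma isCoherentObj_sheafify_yoneda (hP : J.IsCoherentBasis P) {A : C} (hA : P A) :
    IsCoherentObj ((presheafToSheaf J (Type u)).obj (yoneda.obj A)) :=
  ⟨isQuasiCompactObj_of_isFinitelyGenerated hP (isFinitelyGenerated_sheafify_yoneda hA),
    isQuasiSeparatedObj_of_isFinitelySeparated hP (isFinitelySeparated_sheafify_yoneda hP hA)⟩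

omit [HasSheafify J (Type u)] [J.WEqualsLocallyBijective (Type u)] in
lemma exists_binaryProduct (hP : J.IsCoherentBasis P) {A B : C} (hA : P A) (hB : P B) :
    ∃ (W : C) (_ : P W) (c : BinaryFan A B), c.pt = W ∧ Nonempty (IsLimit c) := by
  obtain ⟨T, hT, hPT⟩ := hP.terminal
  obtain ⟨W, p, q, hW, sq⟩ := hP.pullback hA hB hPT (hT.from A) (hT.from B)
  refine ⟨W, hW, BinaryFan.mk p q, rfl, ⟨BinaryFan.isLimitMk (fun s ↦ sq.lift s.fst s.snd
    (hT.hom_ext _ _)) (fun s ↦ sq.lift_fst _ _ _) (fun s ↦ sq.lift_snd _ _ _)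
    fun s m h₁ h₂ ↦ sq.hom_ext (h₁.trans (sq.lift_fst _ _ _).symm)
      (h₂.trans (sq.lift_snd _ _ _).symm)⟩⟩

/-- Sheafification preserves finite products, so this sheaf comes from the basis object `A × A`. It
serves to show that diagonals are quasi-compact. -/
lemma isFinitelySeparated_prod (hP : J.IsCoherentBasis P) {A : C} (hA : P A) :
    IsFinitelySeparated J P
      ((presheafToSheaf J (Type u)).obj (yoneda.obj A) ⨯
        (presheafToSheaf J (Type u)).obj (yoneda.obj A) : Sheaf J (Type u)).obj := by
  obtain ⟨_, hW, c, rfl, ⟨hc⟩⟩ := exists_binaryProduct hP hA hA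
  have h := (mapIsLimitOfPreservesOfIsLimit (yoneda ⋙ presheafToSheaf J (Type u)) c.fst c.snd
    (hc.ofIsoLimit (isoBinaryFanMk c)))
  let e := h.conePointUniqueUpToIso (prodIsProd ((presheafToSheaf J (Type u)).obj (yoneda.obj A))
    ((presheafToSheaf J (Type u)).obj (yoneda.obj A)))
  exact (isFinitelySeparated_sheafify_yoneda hP hW).of_iso ((sheafToPresheaf J _).mapIso e.symm)

lemma isCoherentObj_terminal (hP : J.IsCoherentBasis P) :
    IsCoherentObj (⊤_ (Sheaf J (Type u))) := by
  obtain ⟨T, hT, hPT⟩ := hP.terminal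
  have h := IsTerminal.isTerminalObj (yoneda ⋙ presheafToSheaf J (Type u)) _ hT
  let e := h.uniqueUpToIso (terminalIsTerminal (C := Sheaf J (Type u)))
  exact ⟨(isCoherentObj_sheafify_yoneda hP hPT).1.of_iso e,
    isQuasiSeparatedObj_of_isFinitelySeparated hP
      ((isFinitelySeparated_sheafify_yoneda hP hPT).of_iso ((sheafToPresheaf J _).mapIso e.symm))⟩

theorem isCoherentTopos_of_isCoherentBasis (hP : J.IsCoherentBasis P) :
    IsCoherentTopos (Sheaf J (Type u)) := by
  refine ⟨⟨fun X ↦ ∃ A : C, P A ∧ X = (presheafToSheaf J (Type u)).obj (yoneda.obj A), ?_, ?_⟩,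
    isCoherentObj_terminal hP⟩
  · intro X Y f g h
    ext ⟨U⟩ y
    obtain ⟨S, hS, hd⟩ := hP.dense U
    apply (((isSheaf_iff_isSheaf_of_type _ _).1 Y.property).isSeparated _ hS).ext
    intro V a ha
    obtain ⟨B, hB, b, c, rfl⟩ := hd a ha
    have := ConcreteCategory.congr_hom (NatTrans.congr_app (congrArg (·.hom)
      (h _ ⟨B, hB, rfl⟩ (ofSection X (X.obj.map c.op y)))) (op V))
      ((toSheafify J (yoneda.obj B)).app (op V) b)
    simp only [ObjectProperty.FullSubcategory.comp_hom, NatTrans.comp_app, comp_apply,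
      ofSection_toSheafify] at this
    change Y.obj.map (b ≫ c).op (f.hom.app _ y) = Y.obj.map (b ≫ c).op (g.hom.app _ y)
    rw [← NatTrans.naturality_apply, ← NatTrans.naturality_apply]
    simpa using this
  -- The diagonal is quasi-compact because its source is quasi-compact and its target
  -- quasi-separated.
  · rintro _ ⟨A, hA, rfl⟩
    exact ⟨isCoherentObj_sheafify_yoneda hP hA,
      isQuasiSeparatedObj_of_isFinitelySeparated hP (isFinitelySeparated_prod hP hA) _ _
        (isCoherentObj_sheafify_yoneda hP hA).1⟩

end

end Sheaf

end ToposCoherence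

/-! ### Categories of elements and pro-representability. -/

namespace CategoryTheory

section Elements

variable {D : Type*} [Category* D]

/-- This form of flatness speaks only of elements and maps, so it can be checked directly on
ultraproducts and on sequential colimits. -/
lemma isCofiltered_elements_iff (F : D ⥤ Type u) :
    IsCofiltered F.Elements ↔ (∃ A : D, Nonempty (F.obj A)) ∧
      (∀ ⦃A B : D⦄ (x : F.obj A) (y : F.obj B), ∃ (W : D) (z : F.obj W) (f : W ⟶ A) (g : W ⟶ B),
        F.map f z = x ∧ F.map g z = y) ∧
      ∀ ⦃A B : D⦄ (f g : A ⟶ B) (x : F.obj A), F.map f x = F.map g x →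
        ∃ (W : D) (z : F.obj W) (h : W ⟶ A), F.map h z = x ∧ h ≫ f = h ≫ g := by
  constructor
  · intro h
    refine ⟨⟨h.nonempty.some.1, ⟨h.nonempty.some.2⟩⟩, fun A B x y ↦ ?_, fun A B f g x hx ↦ ?_⟩
    · obtain ⟨⟨W, z⟩, f, g, -⟩ := IsCofilteredOrEmpty.cone_objs (C := F.Elements) ⟨A, x⟩ ⟨B, y⟩
      exact ⟨W, z, f.1, g.1, f.2, g.2⟩
    · obtain ⟨⟨W, z⟩, h, hh⟩ := IsCofilteredOrEmpty.cone_maps (C := F.Elements)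
        (CategoryOfElements.homMk ⟨A, x⟩ ⟨B, F.map f x⟩ f rfl)
        (CategoryOfElements.homMk ⟨A, x⟩ ⟨B, F.map f x⟩ g hx.symm)
      exact ⟨W, z, h.1, h.2, congrArg Subtype.val hh⟩
  · rintro ⟨⟨A, ⟨x⟩⟩, h₁, h₂⟩
    exact
      { cone_objs := fun ⟨A, x⟩ ⟨B, y⟩ ↦ by
          obtain ⟨W, z, f, g, hf, hg⟩ := h₁ x y
          exact ⟨⟨W, z⟩, ⟨f, hf⟩, ⟨g, hg⟩, trivial⟩
        cone_maps := fun ⟨A, x⟩ ⟨B, y⟩ f g ↦ by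
          obtain ⟨W, z, h, hz, hh⟩ := h₂ f.1 g.1 x (f.2.trans g.2.symm)
          exact ⟨⟨W, z⟩, ⟨h, hz⟩, Subtype.ext hh⟩
        nonempty := ⟨⟨A, x⟩⟩ }

/-- A functor to types with cofiltered category of elements is pro-represented by an inverse
system indexed by a directed partially ordered set. -/
lemma exists_directed_system {D : Type u} [SmallCategory D] (F : D ⥤ Type u)
    [IsCofiltered F.Elements] :
    ∃ (N : Type u) (_ : PartialOrder N) (_ : IsDirected N (· ≤ ·)) (_ : Nonempty N)
      (A : N → D) (a : ∀ n, F.obj (A n)) (t : ∀ ⦃n m : N⦄, n ≤ m → (A m ⟶ A n)),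
      (∀ ⦃n m k : N⦄ (h : n ≤ m) (h' : m ≤ k), t h' ≫ t h = t (h.trans h')) ∧
      (∀ ⦃n m : N⦄ (h : n ≤ m), F.map (t h) (a m) = a n) ∧
      (∀ ⦃B : D⦄ (x : F.obj B), ∃ (n : N) (h : A n ⟶ B), F.map h (a n) = x) ∧
      ∀ ⦃B : D⦄ ⦃n m : N⦄ (f : A n ⟶ B) (g : A m ⟶ B), F.map f (a n) = F.map g (a m) →
        ∃ (k : N) (h : n ≤ k) (h' : m ≤ k), t h ≫ f = t h' ≫ g := by
  -- A filtered category receives a final functor from a directed poset; the last two claims are the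
  -- two halves of finality.
  obtain ⟨N, _, _, _, q, _⟩ := IsFiltered.exists_directed F.Elementsᵒᵖ
  refine ⟨N, inferInstance, inferInstance, inferInstance, fun n ↦ (q.obj n).unop.1,
    fun n ↦ (q.obj n).unop.2, fun n m h ↦ (q.map (homOfLE h)).unop.1, ?_, ?_, ?_, ?_⟩
  · intro n m k h h'
    have := q.map_comp (homOfLE h) (homOfLE h')
    exact (congrArg (fun f ↦ f.unop.1) this).symm
  · intro n m h
    exact (q.map (homOfLE h)).unop.2
  · intro B x
    obtain ⟨n, ⟨h⟩⟩ := (q.final_iff_of_isFiltered.1 inferInstance).1 (op ⟨B, x⟩)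
    exact ⟨n, h.unop.1, h.unop.2⟩
  · intro B n m f g h
    obtain ⟨k, hn, hm⟩ := exists_ge_ge n m
    obtain ⟨l, e, he⟩ := (q.final_iff_of_isFiltered.1 inferInstance).2
      (d := op ⟨B, F.map f (q.obj n).unop.2⟩) (c := k)
      (Quiver.Hom.op (CategoryOfElements.homMk (q.obj n).unop
        ⟨B, F.map f (q.obj n).unop.2⟩ f rfl) ≫ q.map (homOfLE hn))
      (Quiver.Hom.op (CategoryOfElements.homMk (q.obj m).unop
        ⟨B, F.map f (q.obj n).unop.2⟩ g h.symm) ≫ q.map (homOfLE hm))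
    have hk : k ≤ l := leOfHom e
    refine ⟨l, hn.trans hk, hm.trans hk, ?_⟩
    have h₁ : q.map (homOfLE (hn.trans hk)) = q.map (homOfLE hn) ≫ q.map e := by
      rw [← q.map_comp]; rfl
    have h₂ : q.map (homOfLE (hm.trans hk)) = q.map (homOfLE hm) ≫ q.map e := by
      rw [← q.map_comp]; rfl
    have := congrArg (fun f ↦ f.unop.1) he
    change (q.map (homOfLE _)).unop.1 ≫ f = (q.map (homOfLE _)).unop.1 ≫ g
    rw [h₁, h₂]
    exact (Category.assoc _ _ _).trans (this.trans (Category.assoc _ _ _).symm)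

end Elements

/-! ### Ultraproducts of representable functors. -/

section Ultraproduct

variable {D : Type u} [SmallCategory D] {I : Type u} (𝒰 : Ultrafilter I) (B : I → D)

/-- Families of morphisms from the objects `B i` to `A` that are defined on a member of the
ultrafilter. -/
def PartialHoms (A : D) : Type u :=
  Σ E : {E : Set I // E ∈ 𝒰}, ∀ i ∈ E.1, (B i ⟶ A)

/-- Eventual equality of partially defined families of morphisms. -/
def PartialHoms.setoid (A : D) : Setoid (PartialHoms 𝒰 B A) where
  r x y := ∀ᶠ i in 𝒰, ∀ (h : i ∈ x.1.1) (h' : i ∈ y.1.1), x.2 i h = y.2 i h'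
  iseqv :=
    { refl x := .of_forall fun i _ _ ↦ rfl
      symm h := h.mono fun i hi a b ↦ (hi b a).symm
      trans {x y z} h h' := by
        filter_upwards [h, h', y.1.2] with i hi hi' hy a b
        exact (hi a hy).trans (hi' hy b) }

/-- The ultraproduct of the functors represented by a family of objects. -/
def ultraHom : D ⥤ Type u where
  obj A := _root_.Quotient (PartialHoms.setoid 𝒰 B A)
  map {A A'} f := ↾_root_.Quotient.map (sa := PartialHoms.setoid 𝒰 B A)
    (sb := PartialHoms.setoid 𝒰 B A') (fun x ↦ ⟨x.1, fun i h ↦ x.2 i h ≫ f⟩)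
    fun x y h ↦ Filter.Eventually.mono h fun i hi a b ↦ by
      change x.2 i a ≫ f = y.2 i b ≫ f
      rw [hi a b]
  map_id A := by
    ext x
    induction x using _root_.Quotient.ind
    exact _root_.Quotient.sound (s := PartialHoms.setoid 𝒰 B A)
      (Filter.Eventually.of_forall fun i _ _ ↦ Category.comp_id _)
  map_comp {A A' A''} f g := by
    ext x
    induction x using _root_.Quotient.ind
    exact _root_.Quotient.sound (s := PartialHoms.setoid 𝒰 B A'')
      (Filter.Eventually.of_forall fun i _ _ ↦ (Category.assoc _ _ _).symm)

namespace ultraHom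

variable {𝒰 B}

/-- The element of the ultraproduct given by a partially defined family of morphisms. -/
def mk {A : D} (E : Set I) (hE : E ∈ 𝒰) (g : ∀ i ∈ E, (B i ⟶ A)) : (ultraHom 𝒰 B).obj A :=
  _root_.Quotient.mk (PartialHoms.setoid 𝒰 B A) ⟨⟨E, hE⟩, g⟩

lemma exists_eq_mk {A : D} (x : (ultraHom 𝒰 B).obj A) :
    ∃ (E : Set I) (hE : E ∈ 𝒰) (g : ∀ i ∈ E, (B i ⟶ A)), x = mk E hE g := by
  obtain ⟨⟨⟨E, hE⟩, g⟩, rfl⟩ := _root_.Quotient.exists_rep x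
  exact ⟨E, hE, g, rfl⟩

lemma mk_eq_mk_iff {A : D} {E E' : Set I} {hE : E ∈ 𝒰} {hE' : E' ∈ 𝒰}
    {g : ∀ i ∈ E, (B i ⟶ A)} {g' : ∀ i ∈ E', (B i ⟶ A)} :
    mk E hE g = mk E' hE' g' ↔ ∀ᶠ i in 𝒰, ∀ (h : i ∈ E) (h' : i ∈ E'), g i h = g' i h' :=
  _root_.Quotient.eq (r := PartialHoms.setoid 𝒰 B A)

@[simp]
lemma map_mk {A A' : D} (f : A ⟶ A') (E : Set I) (hE : E ∈ 𝒰) (g : ∀ i ∈ E, (B i ⟶ A)) :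
    (ultraHom 𝒰 B).map f (mk E hE g) = mk E hE fun i h ↦ g i h ≫ f := rfl

/-- Lifts to products and equalizers are made index by index on a member of the ultrafilter.
Partially defined families are what permits this: `a i` equalizes `f` and `g` only for almost all
`i`. -/
lemma isCofiltered_elements [HasFiniteLimits D] : IsCofiltered (ultraHom 𝒰 B).Elements := by
  rw [isCofiltered_elements_iff]
  refine ⟨⟨⊤_ D, ⟨mk Set.univ Filter.univ_mem fun i _ ↦ terminal.from _⟩⟩, fun A A' x y ↦ ?_,
    fun A A' f g x h ↦ ?_⟩
  · obtain ⟨E, hE, a, rfl⟩ := exists_eq_mk x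
    obtain ⟨E', hE', a', rfl⟩ := exists_eq_mk y
    refine ⟨A ⨯ A', mk (E ∩ E') (Filter.inter_mem hE hE')
      fun i h ↦ prod.lift (a i h.1) (a' i h.2), prod.fst, prod.snd, ?_, ?_⟩
    · rw [map_mk, mk_eq_mk_iff]
      exact .of_forall fun i _ _ ↦ prod.lift_fst _ _
    · rw [map_mk, mk_eq_mk_iff]
      exact .of_forall fun i _ _ ↦ prod.lift_snd _ _
  · obtain ⟨E, hE, a, rfl⟩ := exists_eq_mk x
    rw [map_mk, map_mk, mk_eq_mk_iff] at h
    refine ⟨equalizer f g, mk (E ∩ {i | ∀ (h h' : i ∈ E), a i h ≫ f = a i h' ≫ g})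
      (Filter.inter_mem hE h) fun i hi ↦ equalizer.lift (a i hi.1) (hi.2 hi.1 hi.1),
      equalizer.ι f g, ?_, equalizer.condition f g⟩
    rw [map_mk, mk_eq_mk_iff]
    exact .of_forall fun i _ _ ↦ by simp

end ultraHom

end Ultraproduct

/-! ### Deligne's theorem on enough points. -/

section Deligne

variable {D : Type u} [SmallCategory D] (K : GrothendieckTopology D) {X : D}

/-- A left exact functor to types together with an element over `X` that avoids a sieve `S`, even
after passing to a covering. -/
structure AvoidingFunctor (S : Sieve X) where
  /-- the underlying functor -/
  functor : D ⥤ Type u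
  isCofiltered : IsCofiltered functor.Elements
  /-- the distinguished element -/
  elt : functor.obj X
  avoids ⦃A : D⦄ (x : functor.obj A) (b : A ⟶ X) (h : functor.map b x = elt) : S.pullback b ∉ K A

attribute [instance] AvoidingFunctor.isCofiltered

/-- A topology is finitary if every covering sieve has a finite covering subfamily. -/
def GrothendieckTopology.IsFinitary : Prop :=
  ∀ ⦃U : D⦄ (R : Sieve U), R ∈ K U → ∃ (n : ℕ) (Z : Fin n → D) (g : ∀ i, Z i ⟶ U),
    (∀ i, R (g i)) ∧ Sieve.ofArrows Z g ∈ K U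

variable {K}

/-- Contrapositive of the local character of coverings: avoidance of `S` survives on some member of
any covering. -/
lemma exists_not_mem_of_mem {S : Sieve X} {A : D} {b : A ⟶ X} (hb : S.pullback b ∉ K A)
    (R : Sieve A) (hR : R ∈ K A) :
    ∃ (W : D) (f : W ⟶ A), R f ∧ S.pullback (f ≫ b) ∉ K W := by
  by_contra! h
  refine hb (K.transitive hR _ fun W f hf ↦ ?_)
  rw [← Sieve.pullback_comp]
  exact h W f hf

/-- An avoiding functor can be enlarged so that the elements of the original functor lift along
all coverings. -/
lemma AvoidingFunctor.exists_enlargement [HasFiniteLimits D] (hK : K.IsFinitary) {S : Sieve X}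
    (F : AvoidingFunctor K S) :
    ∃ (F' : AvoidingFunctor K S) (η : F.functor ⟶ F'.functor), η.app _ F.elt = F'.elt ∧
      ∀ ⦃U : D⦄ (x : F.functor.obj U) (R : Sieve U), R ∈ K U →
        ∃ (V : D) (r : V ⟶ U) (_ : R r) (y : F'.functor.obj V),
          F'.functor.map r y = η.app _ x := by
  classical
  obtain ⟨N, _, _, _, A, a, t, ht, ha, hex, heq⟩ := exists_directed_system F.functor
  obtain ⟨n₀, h₀, hn₀⟩ := hex F.elt
  let T := Σ n : N, {R : Sieve (A n) // R ∈ K (A n)}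
  -- `F` is the filtered colimit of the `Hom(A n, -)`. The object `B` refines `A n` enough to factor
  -- through finitely many prescribed coverings while still avoiding `S`; coverings are added one at
  -- a time. Since `n` need not lie above `n₀`, the morphism `d` to `X` is separate data, tied to
  -- `c` only when it does.
  have key (i : N × Finset T) : ∃ (B : D) (c : B ⟶ A i.1) (d : B ⟶ X), S.pullback d ∉ K B ∧
      (∀ h : n₀ ≤ i.1, d = c ≫ t h ≫ h₀) ∧
      ∀ τ ∈ i.2, ∀ h : τ.1 ≤ i.1, τ.2.1 (c ≫ t h) := by
    obtain ⟨n, s⟩ := i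
    induction s using Finset.induction with
    | empty =>
      obtain ⟨m, hm, hm'⟩ := exists_ge_ge n n₀
      refine ⟨A m, t hm, t hm' ≫ h₀, F.avoids (a m) _ ?_, fun h ↦ ?_, by simp⟩
      · rw [Functor.map_comp, comp_apply, ha, hn₀]
      · rw [← Category.assoc, ht]
    | insert τ s _ ih =>
      obtain ⟨B, c, d, h₁, h₂, h₃⟩ := ih
      by_cases hτ : τ.1 ≤ n
      · obtain ⟨W, f, hf, hW⟩ := exists_not_mem_of_mem h₁ (τ.2.1.pullback (c ≫ t hτ))
          (K.pullback_stable _ τ.2.2)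
        refine ⟨W, f ≫ c, f ≫ d, hW, fun h ↦ by rw [h₂ h, Category.assoc], fun τ' hτ' h ↦ ?_⟩
        rw [Finset.mem_insert] at hτ'
        rw [Category.assoc]
        rcases hτ' with rfl | hτ'
        · exact hf
        · exact Sieve.downward_closed _ (h₃ τ' hτ' h) f
      · refine ⟨B, c, d, h₁, h₂, fun τ' hτ' h ↦ ?_⟩
        rw [Finset.mem_insert] at hτ'
        rcases hτ' with rfl | hτ'
        · exact (hτ h).elim
        · exact h₃ τ' hτ' h
  choose B c d hd hcd hT using key
  have : (Filter.atTop : Filter (N × Finset T)).NeBot :=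
    Filter.atTop_neBot_iff.2 ⟨inferInstance, ⟨fun x y ↦ by
      obtain ⟨k, hx, hy⟩ := exists_ge_ge x.1 y.1
      exact ⟨(k, x.2 ∪ y.2), ⟨hx, Finset.subset_union_left⟩, hy, Finset.subset_union_right⟩⟩⟩
  -- Containing all tails, `𝒰` makes every `A n` and every covering in `T` visible to almost all `B
  -- i`.
  let 𝒰 : Ultrafilter (N × Finset T) := Ultrafilter.of Filter.atTop
  have hU (j : N × Finset T) : {i | j ≤ i} ∈ 𝒰 := Ultrafilter.of_le _ (Filter.mem_atTop j)
  have hN (n : N) : {i : N × Finset T | n ≤ i.1} ∈ 𝒰 :=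
    Filter.mem_of_superset (hU (n, ∅)) fun i hi ↦ hi.1
  let e {V : D} (n : N) (f : A n ⟶ V) : (ultraHom 𝒰 B).obj V :=
    ultraHom.mk _ (hN n) fun i hi ↦ c i ≫ t hi ≫ f
  -- The germ depends only on the element of `F`, so arbitrary representatives give a natural `η`.
  have he {V : D} {n m : N} (f : A n ⟶ V) (g : A m ⟶ V)
      (h : F.functor.map f (a n) = F.functor.map g (a m)) : e n f = e m g := by
    obtain ⟨k, hn, hm, hk⟩ := heq f g h
    refine ultraHom.mk_eq_mk_iff.2 ?_
    filter_upwards [hN k] with i hi h h'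
    rw [← ht hn hi, ← ht hm hi, Category.assoc, Category.assoc, hk]
  choose ν h hν using hex
  let η : F.functor ⟶ ultraHom 𝒰 B :=
    { app V := ↾fun x ↦ e (ν x) (h x)
      naturality {V W} f := by
        ext x
        change e (ν (F.functor.map f x)) _ = (ultraHom 𝒰 B).map f (e (ν x) (h x))
        have : (ultraHom 𝒰 B).map f (e (ν x) (h x)) = e (ν x) (h x ≫ f) := by
          simp [e]
        rw [this]
        refine he _ _ ?_
        have h₃ : F.functor.map (h x ≫ f) (a (ν x)) = F.functor.map f x := by
          rw [Functor.map_comp, comp_apply, hν]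
        exact (hν _).trans h₃.symm }
  have hη {V : D} (n : N) (f : A n ⟶ V) : η.app V (F.functor.map f (a n)) = e n f :=
    he _ _ (hν _)
  have hs : η.app X F.elt = e n₀ h₀ := by rw [← hn₀, hη]
  refine ⟨⟨ultraHom 𝒰 B, ultraHom.isCofiltered_elements, η.app X F.elt, fun V x b hb hS ↦ ?_⟩, η,
    rfl, fun U x R hR ↦ ?_⟩
  -- An equality of germs holds at some actual index `i` above `n₀`, where a covering pullback of
  -- `S` would contradict the choice of `B i`.
  · obtain ⟨E, hE, g, rfl⟩ := ultraHom.exists_eq_mk x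
    rw [hs, ultraHom.map_mk, ultraHom.mk_eq_mk_iff] at hb
    obtain ⟨i, ⟨hi, hi'⟩, hi''⟩ := 𝒰.nonempty_of_mem
      (Filter.inter_mem (Filter.inter_mem hb hE) (hN n₀))
    refine hd i ?_
    rw [hcd i hi'', ← hi hi' hi'', Sieve.pullback_comp]
    exact K.pullback_stable _ hS
  · obtain ⟨n, Z, g, hg, hcov⟩ := hK R hR
    let τ : T := ⟨ν x, (Sieve.ofArrows Z g).pullback (h x), K.pullback_stable _ hcov⟩
    have hτ : ∀ᶠ i in 𝒰, ∃ k : Fin n, ∃ (hi : ν x ≤ i.1) (y : B i ⟶ Z k),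
        y ≫ g k = c i ≫ t hi ≫ h x := by
      filter_upwards [hU (ν x, {τ})] with i hi
      obtain ⟨_, y, _, ⟨k⟩, hy⟩ := hT i τ (hi.2 (by simp)) hi.1
      exact ⟨k, hi.1, y, by simpa using hy⟩
    -- Here finiteness of coverings is essential: an ultrafilter selects one member of a finite
    -- family through which almost all `B i` factor.
    rw [Ultrafilter.eventually_exists_iff] at hτ
    obtain ⟨k, hk⟩ := hτ
    refine ⟨Z k, g k, hg k, ultraHom.mk _ hk fun i hi ↦ hi.choose_spec.choose, ?_⟩
    refine ultraHom.mk_eq_mk_iff.2 (.of_forall fun i hi hi' ↦ ?_)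
    exact hi.choose_spec.choose_spec

/-- If `S` is not a covering sieve for a finitary topology, then there is a left exact functor
with an element that avoids `S`, whose elements lift along all coverings. -/
theorem exists_avoidingFunctor [HasFiniteLimits D] (hK : K.IsFinitary) (S : Sieve X)
    (hS : S ∉ K X) :
    ∃ F : AvoidingFunctor K S, ∀ ⦃U : D⦄ (x : F.functor.obj U) (R : Sieve U), R ∈ K U →
      ∃ (V : D) (r : V ⟶ U) (_ : R r) (y : F.functor.obj V), F.functor.map r y = x := by
  have hF₀ : IsCofiltered (coyoneda.obj (op X) ⋙ 𝟭 (Type u)).Elements := by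
    rw [isCofiltered_elements_iff]
    refine ⟨⟨X, ⟨𝟙 X⟩⟩, fun A B x y ↦ ⟨X, 𝟙 X, x, y, ?_, ?_⟩,
      fun A B f g x h ↦ ⟨X, 𝟙 X, x, ?_, h⟩⟩ <;>
      exact Category.id_comp _
  let F₀ : AvoidingFunctor K S :=
    { functor := coyoneda.obj (op X) ⋙ 𝟭 (Type u)
      isCofiltered := hF₀
      elt := 𝟙 X
      avoids A x b h hb := hS (by
        have := K.pullback_stable x hb
        rw [← Sieve.pullback_comp] at this
        rw [show x ≫ b = 𝟙 X from h, Sieve.pullback_id] at this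
        exact this) }
  choose next η hη hlift using AvoidingFunctor.exists_enlargement hK (S := S)
  let G (n : ℕ) : AvoidingFunctor K S := Nat.rec F₀ (fun _ F ↦ next F) n
  let γ (n : ℕ) : (G n).functor ⟶ (G (n + 1)).functor := η (G n)
  let H : ℕ ⥤ (D ⥤ Type u) := Functor.ofSequence γ
  have hHs (n : ℕ) : H.map (homOfLE (Nat.le_add_right n 1)) = γ n :=
    Functor.ofSequence_map_homOfLE_succ γ n
  have helt (n m : ℕ) (h : n ≤ m) : (H.map (homOfLE h)).app X (G n).elt = (G m).elt := by
    induction m, h using Nat.le_induction with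
    | base => exact ConcreteCategory.congr_hom (NatTrans.congr_app (H.map_id n) X) _
    | succ m h ih =>
      have := H.map_comp (homOfLE h) (homOfLE (Nat.le_add_right m 1))
      refine (ConcreteCategory.congr_hom (NatTrans.congr_app this X) _).trans ?_
      change (H.map (homOfLE _)).app X ((H.map (homOfLE h)).app X (G n).elt) = _
      rw [ih, hHs]
      exact hη (G m)
  -- Cofilteredness and avoidance are tested at a finite stage, and an element of stage `n` lifts
  -- along a covering at stage `n + 1`.
  let L := colimit H
  let ι (n : ℕ) : (G n).functor ⟶ L := colimit.ι H n
  have hι (n m : ℕ) (h : n ≤ m) (A : D) (x : (G n).functor.obj A) :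
      (ι m).app A ((H.map (homOfLE h)).app A x) = (ι n).app A x :=
    ConcreteCategory.congr_hom (NatTrans.congr_app (colimit.w H (homOfLE h)) A) x
  have hex (A : D) (x : L.obj A) : ∃ (n : ℕ) (y : (G n).functor.obj A), (ι n).app A y = x :=
    Types.jointly_surjective_of_isColimit
      (isColimitOfPreserves ((evaluation _ _).obj A) (colimit.isColimit H)) x
  have heq (A : D) (n : ℕ) (x y : (G n).functor.obj A) (h : (ι n).app A x = (ι n).app A y) :
      ∃ (m : ℕ) (h : n ≤ m), (H.map (homOfLE h)).app A x = (H.map (homOfLE h)).app A y := by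
    obtain ⟨m, f, hf⟩ := (Types.FilteredColimit.isColimit_eq_iff'
      (isColimitOfPreserves ((evaluation _ _).obj A) (colimit.isColimit H)) x y).1 h
    exact ⟨m, leOfHom f, hf⟩
  have hex₂ (A B : D) (x : L.obj A) (y : L.obj B) : ∃ (n : ℕ) (x' : (G n).functor.obj A)
      (y' : (G n).functor.obj B), (ι n).app A x' = x ∧ (ι n).app B y' = y := by
    obtain ⟨n, x, rfl⟩ := hex A x
    obtain ⟨m, y, rfl⟩ := hex B y
    exact ⟨max n m, _, _, hι _ _ (le_max_left n m) _ _, hι _ _ (le_max_right n m) _ _⟩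
  refine ⟨⟨L, ?_, (ι 0).app X F₀.elt, fun A x b h hb ↦ ?_⟩, fun U x R hR ↦ ?_⟩
  · rw [isCofiltered_elements_iff]
    refine ⟨⟨X, ⟨(ι 0).app X F₀.elt⟩⟩, fun A B x y ↦ ?_, fun A B f g x h ↦ ?_⟩
    · obtain ⟨n, x, y, rfl, rfl⟩ := hex₂ A B x y
      obtain ⟨W, z, f, g, rfl, rfl⟩ :=
        ((isCofiltered_elements_iff _).1 (G n).isCofiltered).2.1 x y
      exact ⟨W, (ι n).app W z, f, g, (NatTrans.naturality_apply _ _ _).symm,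
        (NatTrans.naturality_apply _ _ _).symm⟩
    · obtain ⟨n, x, rfl⟩ := hex A x
      rw [← NatTrans.naturality_apply, ← NatTrans.naturality_apply] at h
      obtain ⟨m, hm, h⟩ := heq _ _ _ _ h
      erw [NatTrans.naturality_apply, NatTrans.naturality_apply] at h
      obtain ⟨W, z, k, hz, hk⟩ :=
        ((isCofiltered_elements_iff _).1 (G m).isCofiltered).2.2 f g _ h
      refine ⟨W, (ι m).app W z, k, ?_, hk⟩
      rw [← NatTrans.naturality_apply, hz]
      exact hι _ _ _ _ _
  · obtain ⟨n, x, rfl⟩ := hex A x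
    rw [← hι 0 n (Nat.zero_le n), ← NatTrans.naturality_apply] at h
    obtain ⟨m, hm, h⟩ := heq _ _ _ _ h
    erw [NatTrans.naturality_apply, helt 0 n, helt n m] at h
    exact (G m).avoids _ _ h hb
  · obtain ⟨n, x, rfl⟩ := hex U x
    obtain ⟨V, r, hr, y, hy⟩ := hlift (G n) x R hR
    refine ⟨V, r, hr, (ι (n + 1)).app V y, ?_⟩
    rw [← NatTrans.naturality_apply]
    refine (congrArg _ hy).trans ?_
    rw [← hι n (n + 1) (Nat.le_add_right n 1), hHs]
    rfl

/-- Deligne's theorem: the sheaves on a small finitely complete site all of whose coverings have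
finite subcoverings have enough points. -/
theorem GrothendieckTopology.IsFinitary.hasEnoughPoints [HasFiniteLimits D]
    [HasSheafify K (Type u)] (hK : K.IsFinitary) :
    GrothendieckTopology.HasEnoughPoints.{u} K := by
  choose F hF using fun (p : Σ X : D, {S : Sieve X // S ∉ K X}) ↦
    exists_avoidingFunctor hK p.2.1 p.2.2
  let Φ (p : Σ X : D, {S : Sieve X // S ∉ K X}) : K.Point :=
    { fiber := (F p).functor
      isCofiltered := (F p).isCofiltered
      initiallySmall := initiallySmall_of_essentiallySmall _
      jointly_surjective R hR x := by
        obtain ⟨V, r, hr, y, hy⟩ := hF p x R hR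
        exact ⟨V, r, hr, y, hy⟩ }
  refine ⟨ObjectProperty.ofObj Φ, inferInstance,
    ObjectProperty.IsConservativeFamilyOfPoints.mk' fun X S hS ↦ by_contra fun h ↦ ?_⟩
  -- A lift along `g` in `S` contradicts avoidance, as `S` pulls back to the maximal sieve along
  -- `g`.
  obtain ⟨Y, g, hg, y, hy⟩ := hS ⟨Φ ⟨X, S, h⟩, ⟨_⟩⟩ (F ⟨X, S, h⟩).elt
  refine (F ⟨X, S, h⟩).avoids y g hy ?_
  rw [S.pullback_eq_top_of_mem hg]
  exact K.top_mem _

end Deligne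

end CategoryTheory

/-! ### Passage from a large site to a small coherent basis. -/

namespace CategoryTheory

namespace GrothendieckTopology

/-- The fibre of a sheaf at a transported point is the fibre of its restriction at the original
point, and restriction, being an equivalence, reflects isomorphisms. -/
lemma HasEnoughPoints.of_isEquivalence {C : Type (u + 1)} [Category.{u} C]
    {J : GrothendieckTopology C} {D : Type u} [SmallCategory D] (K : GrothendieckTopology D)
    (G : D ⥤ C) [G.IsDenseSubsite K J]
    [(G.sheafPushforwardContinuous (Type u) K J).IsEquivalence]
    [HasEnoughPoints.{u} K] : HasEnoughPoints.{u} J := by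
  obtain ⟨Q, _, hQ⟩ := HasEnoughPoints.exists_objectProperty.{u} K
  refine ⟨ObjectProperty.ofObj fun Φ : Subtype Q ↦ Φ.1.map G J, inferInstance, ⟨⟨?_⟩⟩⟩
  intro F F' f hf
  have : IsIso ((G.sheafPushforwardContinuous (Type u) K J).map f) := by
    refine (hQ.jointlyReflectIsomorphisms_type.isIso_iff _).2 fun Φ ↦ ?_
    have := hf ⟨_, ⟨⟨Φ.obj, Φ.property⟩⟩⟩
    exact ((MorphismProperty.isomorphisms _).arrow_mk_iso_iff
      ((Functor.mapArrowFunctor _ _).mapIso (Φ.obj.sheafFiberMapIso G J (A := Type u)) |>.app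
        (Arrow.mk f))).1 this
  exact isIso_of_reflects_iso f (G.sheafPushforwardContinuous (Type u) K J)

namespace IsCoherentBasis

variable {C : Type (u + 1)} [Category.{u} C] {J : GrothendieckTopology C} {P : ObjectProperty C}
  {D : Type u} [SmallCategory D] {G : D ⥤ C} [G.Full] [G.Faithful]

lemma hasFiniteLimits (hP : J.IsCoherentBasis P) (hG : ∀ d, P (G.obj d))
    (hG' : ∀ A, P A → ∃ d, Nonempty (G.obj d ≅ A)) : HasFiniteLimits D := by
  have : HasTerminal D := by
    obtain ⟨T, hT, hPT⟩ := hP.terminal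
    obtain ⟨d, ⟨e⟩⟩ := hG' T hPT
    exact (IsTerminal.isTerminalOfObj G d (hT.ofIso e.symm)).hasTerminal
  have : HasPullbacks D := by
    refine @hasPullbacks_of_hasLimit_cospan _ _ fun {A B E f g} ↦ ?_
    obtain ⟨W, p, q, hW, h⟩ := hP.pullback (hG A) (hG B) (hG E) (G.map f) (G.map g)
    obtain ⟨d, ⟨e⟩⟩ := hG' W hW
    have h' : IsPullback (G.map (G.preimage (e.hom ≫ p))) (G.map (G.preimage (e.hom ≫ q)))
        (G.map f) (G.map g) := by
      rw [G.map_preimage, G.map_preimage]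
      exact h.of_iso e.symm (Iso.refl _) (Iso.refl _) (Iso.refl _) (by simp) (by simp) (by simp)
        (by simp)
    exact (IsPullback.of_map_of_faithful G h').hasPullback
  exact hasFiniteLimits_of_hasTerminal_and_pullbacks

lemma isFinitary_inducedTopology (hP : J.IsCoherentBasis P) [G.IsCoverDense J]
    (hG : ∀ d, P (G.obj d)) : (G.inducedTopology J).IsFinitary := by
  intro U R hR
  rw [Functor.mem_inducedTopology_iff_of_isCoverDense] at hR
  obtain ⟨n, Z, g, -, hg, hZ⟩ := hP.finite (hG U) _ hR
  choose W r h hr hfac using hg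
  refine ⟨n, W, r, hr, ?_⟩
  rw [Functor.mem_inducedTopology_iff_of_isCoverDense]
  refine J.superset_covering ?_ hZ
  rw [Sieve.ofArrows, Sieve.generate_le_iff]
  rintro _ _ ⟨i⟩
  exact ⟨W i, r i, h i, Sieve.ofArrows_mk _ _ i, hfac i⟩

/-- A site with an essentially small coherent basis has sheafification and enough points. -/
theorem hasEnoughPoints (hP : J.IsCoherentBasis P) [HasPullbacks C]
    [ObjectProperty.EssentiallySmall.{u} P]
    (hd : ∀ A : C, ∃ (ι : Type u) (Z : ι → C) (g : ∀ i, Z i ⟶ A), (∀ i, P (Z i)) ∧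
      Sieve.ofArrows Z g ∈ J A) :
    HasSheafify J (Type u) ∧ J.WEqualsLocallyBijective (Type u) ∧ HasEnoughPoints.{u} J := by
  let G : SmallModel.{u} P.FullSubcategory ⥤ C := (equivSmallModel.{u} _).inverse ⋙ P.ι
  have hG (d) : P (G.obj d) := ((equivSmallModel.{u} P.FullSubcategory).inverse.obj d).property
  have hG' (A) (hA : P A) : ∃ d, Nonempty (G.obj d ≅ A) :=
    ⟨(equivSmallModel.{u} _).functor.obj ⟨A, hA⟩,
      ⟨P.ι.mapIso ((equivSmallModel.{u} P.FullSubcategory).unitIso.app ⟨A, hA⟩).symm⟩⟩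
  have hd' (A : C) : ∃ (ι : Type u) (Z : ι → SmallModel.{u} P.FullSubcategory)
      (g : ∀ i, G.obj (Z i) ⟶ A), Sieve.ofArrows _ g ∈ J A := by
    obtain ⟨ι, Z, g, hZ, hg⟩ := hd A
    choose d e using fun i ↦ hG' _ (hZ i)
    refine ⟨ι, d, fun i ↦ (e i).some.hom ≫ g i, J.superset_covering ?_ hg⟩
    rw [Sieve.ofArrows, Sieve.generate_le_iff]
    rintro _ _ ⟨i⟩
    exact ⟨_, (e i).some.inv, _, ⟨i⟩, by simp⟩
  have : G.IsCoverDense J := ⟨fun A ↦ by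
    obtain ⟨ι, Z, g, hg⟩ := hd' A
    refine J.superset_covering ?_ hg
    rw [Sieve.ofArrows, Sieve.generate_le_iff]
    rintro _ _ ⟨i⟩
    exact ⟨⟨Z i, 𝟙 _, g i, by simp⟩⟩⟩
  have : HasFiniteLimits (SmallModel.{u} P.FullSubcategory) := hP.hasFiniteLimits hG hG'
  have hK := hP.isFinitary_inducedTopology hG
  have : HasEnoughPoints.{u} (G.inducedTopology J) := hK.hasEnoughPoints
  -- Small coverings by basis objects make restriction to the small site an equivalence;
  -- sheafification on the large site is then transported along it.
  have : Functor.IsOneHypercoverDense.{u} G (G.inducedTopology J) J := .of_hasPullbacks hd'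
  have : (G.sheafPushforwardContinuous (Type u) (G.inducedTopology J) J).IsEquivalence :=
    Functor.isEquivalence_of_isOneHypercoverDense _ _ _ _
  have : HasSheafify J (Type u) :=
    Functor.IsDenseSubsite.hasSheafify_of_isEquivalence (G.inducedTopology J) J G
  exact ⟨this, .transport _ _ _ (Functor.IsDenseSubsite.coverPreserving (G.inducedTopology J) _ G),
    .of_isEquivalence (G.inducedTopology J) G⟩

end IsCoherentBasis

end GrothendieckTopology

end CategoryTheory

/-! ### Finite refinements in a generated topology. -/

namespace CategoryTheory

section

variable {C : Type w} [Category.{v} C]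

/-- A sieve has a finite refinement by objects of `P` if it contains a finite covering family
whose members have sources in `P`. -/
def Sieve.HasFiniteRefinement (J : GrothendieckTopology C) (P : ObjectProperty C) {B : C}
    (S : Sieve B) : Prop :=
  ∃ (ι : Type) (_ : Finite ι) (Z : ι → C) (g : ∀ i, Z i ⟶ B),
    (∀ i, P (Z i)) ∧ (∀ i, S (g i)) ∧ Sieve.ofArrows Z g ∈ J B

/-- Induction on the construction of the covering sieve. Quantifying over all pullbacks to objects
of `P` is what makes the pullback and transitivity cases go through. -/
lemma Precoverage.hasFiniteRefinement_of_mem (K : Precoverage C) (P : ObjectProperty C)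
    (h : ∀ ⦃A : C⦄ (R : Presieve A), R ∈ K A → ∀ ⦃B : C⦄, P B → ∀ g : B ⟶ A,
      ((Sieve.generate R).pullback g).HasFiniteRefinement K.toGrothendieck P)
    {A : C} (S : Sieve A) (hS : S ∈ K.toGrothendieck A) {B : C} (hB : P B) (g : B ⟶ A) :
    (S.pullback g).HasFiniteRefinement K.toGrothendieck P := by
  replace hS : K.Saturate A S := hS
  induction hS generalizing B with
  | of A R hR => exact h R hR hB g
  | top A =>
    refine ⟨Unit, inferInstance, fun _ ↦ B, fun _ ↦ 𝟙 B, fun _ ↦ hB, fun _ ↦ trivial, ?_⟩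
    have : Sieve.ofArrows (fun _ : Unit ↦ B) (fun _ ↦ 𝟙 B) = ⊤ :=
      Sieve.id_mem_iff_eq_top.1 (Sieve.ofArrows_mk _ _ ())
    rw [this]
    exact K.toGrothendieck.top_mem B
  | pullback A S _ A' f ih =>
    rw [← Sieve.pullback_comp]
    exact ih hB (g ≫ f)
  | transitive A S R _ _ ih ih' =>
    obtain ⟨ι, _, Z, k, hZ, hk, hc⟩ := ih hB g
    choose κ _ W l hW hl hc' using fun i ↦ ih' (hk i) (hZ i) (𝟙 (Z i))
    refine ⟨Σ i, κ i, inferInstance, fun j ↦ W j.1 j.2, fun j ↦ l j.1 j.2 ≫ k j.1,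
      fun j ↦ hW _ _, fun j ↦ ?_, ?_⟩
    · simpa using hl j.1 j.2
    · refine K.toGrothendieck.transitive hc _ ?_
      rintro Y _ ⟨_, a, _, ⟨i⟩, rfl⟩
      rw [Sieve.pullback_comp]
      refine K.toGrothendieck.pullback_stable a (K.toGrothendieck.superset_covering ?_ (hc' i))
      rw [Sieve.ofArrows, Sieve.generate_le_iff]
      rintro _ _ ⟨j⟩
      exact Sieve.ofArrows_mk (fun j : Σ i, κ i ↦ W j.1 j.2) (fun j ↦ l j.1 j.2 ≫ k j.1) ⟨i, j⟩

lemma GrothendieckTopology.ofArrows_comp_mem (J : GrothendieckTopology C) {B : C} {ι κ : Type*}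
    (e : κ ≃ ι) {Z : ι → C} {g : ∀ i, Z i ⟶ B} (h : Sieve.ofArrows Z g ∈ J B) :
    Sieve.ofArrows (fun i ↦ Z (e i)) (fun i ↦ g (e i)) ∈ J B := by
  refine J.superset_covering ?_ h
  rw [Sieve.ofArrows, Sieve.generate_le_iff]
  rintro _ _ ⟨i⟩
  obtain ⟨i, rfl⟩ := e.surjective i
  exact Sieve.ofArrows_mk (fun i ↦ Z (e i)) (fun i ↦ g (e i)) i

lemma GrothendieckTopology.ofArrows_mem_of_comp (J : GrothendieckTopology C) {B : C} {ι κ : Type*}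
    (e : κ → ι) {Z : ι → C} {g : ∀ i, Z i ⟶ B}
    (h : Sieve.ofArrows (fun i ↦ Z (e i)) (fun i ↦ g (e i)) ∈ J B) : Sieve.ofArrows Z g ∈ J B := by
  refine J.superset_covering ?_ h
  rw [Sieve.ofArrows, Sieve.generate_le_iff]
  rintro _ _ ⟨i⟩
  exact Sieve.ofArrows_mk Z g (e i)

lemma Sieve.HasFiniteRefinement.mk {J : GrothendieckTopology C} {P : ObjectProperty C}
    {B : C} {S : Sieve B} {ι : Type*} [Finite ι] (Z : ι → C) (g : ∀ i, Z i ⟶ B)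
    (hZ : ∀ i, P (Z i)) (hg : ∀ i, S (g i)) (h : Sieve.ofArrows Z g ∈ J B) :
    S.HasFiniteRefinement J P := by
  obtain ⟨n, ⟨e⟩⟩ := Finite.exists_equiv_fin ι
  exact ⟨Fin n, inferInstance, fun i ↦ Z (e.symm i), fun i ↦ g _, fun i ↦ hZ _, fun i ↦ hg _,
    J.ofArrows_comp_mem e.symm h⟩

lemma Sieve.HasFiniteRefinement.exists_fin {J : GrothendieckTopology C} {P : ObjectProperty C}
    {B : C} {S : Sieve B} (h : S.HasFiniteRefinement J P) :
    ∃ (n : ℕ) (Z : Fin n → C) (g : ∀ i, Z i ⟶ B),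
      (∀ i, P (Z i)) ∧ (∀ i, S (g i)) ∧ Sieve.ofArrows Z g ∈ J B := by
  obtain ⟨ι, _, Z, g, hZ, hg, hc⟩ := h
  obtain ⟨n, ⟨e⟩⟩ := Finite.exists_equiv_fin ι
  exact ⟨n, fun i ↦ Z (e.symm i), fun i ↦ g _, fun i ↦ hZ _, fun i ↦ hg _,
    J.ofArrows_comp_mem e.symm hc⟩

end

end CategoryTheory

/-! ### Finite étale morphisms. -/

namespace AlgebraicGeometry

/-- The class of finite étale morphisms. -/
def finiteEtale : MorphismProperty Scheme.{u} := fun _ _ f ↦ IsFinite f ∧ Etale f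

namespace finiteEtale

instance : MorphismProperty.HasOfPostcompProperty finiteEtale.{u} finiteEtale.{u} where
  of_postcomp f g hg hfg := by
    obtain ⟨_, _⟩ := hg
    obtain ⟨_, _⟩ := hfg
    exact ⟨IsFinite.of_comp f g, Etale.of_comp f g⟩

instance : finiteEtale.{u}.IsStableUnderBaseChange where
  of_isPullback h hf :=
    ⟨MorphismProperty.of_isPullback h hf.1, MorphismProperty.of_isPullback h hf.2⟩

instance : finiteEtale.{u}.IsMultiplicative where
  id_mem _ := ⟨inferInstance, inferInstance⟩
  comp_mem f g hf hg := by
    obtain ⟨_, _⟩ := hf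
    obtain ⟨_, _⟩ := hg
    exact ⟨inferInstance, inferInstance⟩

end finiteEtale

end AlgebraicGeometry

/-! ### Finite limits in the Faltings site. -/

namespace FaltingsObj

variable {X Y : Scheme.{u}} {f : Y ⟶ X}

lemma hom_ext {A B : FaltingsObj f} {a b : A ⟶ B} (h : a.left = b.left) (h' : a.right = b.right) :
    a = b := Hom.ext h h'

attribute [instance] etale_toX

lemma finiteEtale_lift (A : FaltingsObj f) {T : Scheme.{u}} {t₁ : T ⟶ A.U} {t₂ : T ⟶ Y}
    (h : IsPullback t₁ t₂ A.toX f) {e : A.V ⟶ T} (h₁ : e ≫ t₁ = A.hom) (h₂ : e ≫ t₂ = A.toY) :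
    finiteEtale e := by
  have : e = pullback.lift A.hom A.toY A.w ≫ h.isoPullback.inv := by
    refine h.hom_ext ?_ ?_
    · rw [h₁, Category.assoc, h.isoPullback_inv_fst, pullback.lift_fst]
    · rw [h₂, Category.assoc, h.isoPullback_inv_snd, pullback.lift_snd]
  rw [this, finiteEtale.cancel_right_of_respectsIso]
  exact ⟨A.finite_lift, A.etale_lift⟩

/-- Construct an object of the Faltings site using an arbitrary model of the fibre product. -/
def ofIsPullback {V U T : Scheme.{u}} {t₁ : T ⟶ U} {t₂ : T ⟶ Y} {toX : U ⟶ X}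
    (h : IsPullback t₁ t₂ toX f) (e : V ⟶ T) (he : finiteEtale e) (hX : Etale toX)
    (hom : V ⟶ U) (toY : V ⟶ Y) (h₁ : e ≫ t₁ = hom) (h₂ : e ≫ t₂ = toY) : FaltingsObj f :=
  have w : hom ≫ toX = toY ≫ f := by rw [← h₁, ← h₂, Category.assoc, Category.assoc, h.w]
  have he' : finiteEtale (pullback.lift hom toY w : V ⟶ pullback toX f) := by
    have : pullback.lift hom toY w = e ≫ h.isoPullback.hom := by
      refine pullback.hom_ext ?_ ?_
      · rw [pullback.lift_fst, Category.assoc, h.isoPullback_hom_fst, h₁]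
      · rw [pullback.lift_snd, Category.assoc, h.isoPullback_hom_snd, h₂]
    rw [this, finiteEtale.cancel_right_of_respectsIso]
    exact he
  { V, U, hom, toY, toX, w
    etale_toX := hX
    finite_lift := he'.1
    etale_lift := he'.2 }

instance (A : FaltingsObj f) : Etale A.toY := by
  have := A.etale_lift
  rw [← pullback.lift_snd A.hom A.toY A.w]
  infer_instance

/-- A morphism between étale `Y`-schemes is étale. Together with `etale_right`, this reduces the
étale covering condition to joint surjectivity. -/
instance etale_left {A B : FaltingsObj f} (g : A ⟶ B) : Etale g.left := by
  have : Etale (g.left ≫ B.toY) := by rw [g.left_toY]; infer_instance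
  exact Etale.of_comp g.left B.toY

instance etale_right {A B : FaltingsObj f} (g : A ⟶ B) : Etale g.right := by
  have : Etale (g.right ≫ B.toX) := by rw [g.right_toX]; infer_instance
  exact Etale.of_comp g.right B.toX

section Restrict

variable (A : FaltingsObj f) {W : Scheme.{u}} (h : W ⟶ A.U) [Etale h]

omit [Etale h] in
-- The morphism `V ×_U W ⟶ W ×_X Y` is the base change of `V ⟶ U ×_X Y` along `W ×_X Y ⟶ U ×_X Y`.
lemma finiteEtale_restrict {P T : Scheme.{u}} {p : P ⟶ A.V} {q : P ⟶ W}
    (hP : IsPullback p q A.hom h) {t₁ : T ⟶ W} {t₂ : T ⟶ Y}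
    (hT : IsPullback t₁ t₂ (h ≫ A.toX) f) {e : P ⟶ T} (h₁ : e ≫ t₁ = q)
    (h₂ : e ≫ t₂ = p ≫ A.toY) : finiteEtale e := by
  let k : T ⟶ pullback A.toX f := pullback.lift (t₁ ≫ h) t₂ (by rw [Category.assoc, hT.w])
  have hk : IsPullback k t₁ (pullback.fst A.toX f) h := by
    refine IsPullback.of_right (h₁₂ := pullback.snd A.toX f) (h₂₂ := A.toX) (v₁₃ := f) ?_ ?_
      (IsPullback.of_hasPullback A.toX f).flip
    · rw [pullback.lift_snd]
      exact hT.flip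
    · exact pullback.lift_fst _ _ _
  have hp : IsPullback p e (pullback.lift A.hom A.toY A.w) k := by
    refine IsPullback.of_bot (v₂₁ := t₁) (v₂₂ := pullback.fst A.toX f) (h₃₁ := h) ?_ ?_ hk
    · rw [pullback.lift_fst, h₁]
      exact hP
    · refine pullback.hom_ext ?_ ?_
      · rw [Category.assoc, Category.assoc, pullback.lift_fst, pullback.lift_fst, reassoc_of% h₁,
          hP.w]
      · rw [Category.assoc, Category.assoc, pullback.lift_snd, pullback.lift_snd, h₂]
  exact MorphismProperty.of_isPullback hp ⟨A.finite_lift, A.etale_lift⟩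

/-- The restriction of an object `(V ⟶ U)` along an étale morphism `W ⟶ U`. -/
noncomputable def restrict : FaltingsObj f :=
  ofIsPullback (V := pullback A.hom h) (U := W) (toX := h ≫ A.toX)
    (IsPullback.of_hasPullback (h ≫ A.toX) f)
    (pullback.lift (pullback.snd _ _) (pullback.fst A.hom h ≫ A.toY)
      (by rw [Category.assoc, ← A.w, pullback.condition_assoc]))
    (A.finiteEtale_restrict h (.of_hasPullback _ _) (.of_hasPullback _ _)
      (pullback.lift_fst _ _ _) (pullback.lift_snd _ _ _))
    inferInstance (pullback.snd _ _) (pullback.fst A.hom h ≫ A.toY)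
    (pullback.lift_fst _ _ _) (pullback.lift_snd _ _ _)

/-- The projection from a restriction. -/
noncomputable def restrictHom : A.restrict h ⟶ A where
  left := pullback.fst _ _
  right := h
  left_toY := rfl
  right_toX := rfl
  comm := pullback.condition

lemma isPullback_restrictHom :
    IsPullback (A.restrictHom h).left (A.restrict h).hom A.hom (A.restrictHom h).right :=
  IsPullback.of_hasPullback _ _

end Restrict

/-- Both `B.V` and `A.V ×_{A.U} B.U` are finite étale over `B.U ×_X Y`, so any morphism between them
over it is finite étale. -/
lemma finiteEtale_of_isPullback {A B : FaltingsObj f} (g : B ⟶ A) {R : Scheme.{u}} {p : R ⟶ A.V}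
    {q : R ⟶ B.U} (hR : IsPullback p q A.hom g.right) {e : B.V ⟶ R} (h₁ : e ≫ p = g.left)
    (h₂ : e ≫ q = B.hom) : finiteEtale e := by
  have hT := IsPullback.of_hasPullback B.toX f
  have hT' : IsPullback (pullback.fst B.toX f) (pullback.snd B.toX f) (g.right ≫ A.toX) f := by
    rw [g.right_toX]
    exact hT
  let k : R ⟶ pullback B.toX f := pullback.lift q (p ≫ A.toY) (by
    rw [← g.right_toX, Category.assoc, ← A.w, hR.w_assoc])
  have hk : finiteEtale k := A.finiteEtale_restrict g.right hR hT' (e := k)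
    (pullback.lift_fst _ _ _) (pullback.lift_snd _ _ _)
  refine MorphismProperty.of_postcomp _ e k hk ?_
  refine B.finiteEtale_lift hT ?_ ?_
  · rw [Category.assoc, pullback.lift_fst, h₂]
  · rw [Category.assoc, pullback.lift_snd, reassoc_of% h₁, g.left_toY]

section Pullback

variable {A B D : FaltingsObj f} (a : A ⟶ D) (b : B ⟶ D)

/-- With `S = A.U ×_{D.U} B.U`, this exhibits `A.V ×_{D.V} B.V ⟶ A.V ×_{A.U} S` as a base change of
`B.V ⟶ D.V ×_{D.U} B.U`. -/
lemma isPullback_lift_fiberProd {P S T R : Scheme.{u}} {p₁ : P ⟶ A.V} {p₂ : P ⟶ B.V}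
    (hP : IsPullback p₁ p₂ a.left b.left) {s₁ : S ⟶ A.U} {s₂ : S ⟶ B.U}
    (hS : IsPullback s₁ s₂ a.right b.right) {t₁ : T ⟶ A.V} {t₂ : T ⟶ S}
    (hT : IsPullback t₁ t₂ A.hom s₁) {r₁ : R ⟶ D.V} {r₂ : R ⟶ B.U}
    (hR : IsPullback r₁ r₂ D.hom b.right) {e : P ⟶ T} (he₁ : e ≫ t₁ = p₁)
    (he₂ : e ≫ t₂ ≫ s₂ = p₂ ≫ B.hom) {k : T ⟶ R} (hk₁ : k ≫ r₁ = t₁ ≫ a.left)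
    (hk₂ : k ≫ r₂ = t₂ ≫ s₂) {l : B.V ⟶ R} (hl₁ : l ≫ r₁ = b.left) (hl₂ : l ≫ r₂ = B.hom) :
    IsPullback p₂ e l k := by
  have h₁ : IsPullback t₁ k a.left r₁ := by
    refine IsPullback.of_bot (v₂₁ := r₂) (v₂₂ := D.hom) (h₃₁ := b.right) ?_ hk₁.symm hR
    rw [hk₂, a.comm]
    exact hT.paste_vert hS
  refine IsPullback.of_bot (v₂₁ := t₁) (v₂₂ := r₁) (h₃₁ := a.left) ?_ ?_ h₁.flip
  · rw [he₁, hl₁]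
    exact hP.flip
  · refine hR.hom_ext ?_ ?_
    · rw [Category.assoc, Category.assoc, hl₁, hk₁, reassoc_of% he₁, hP.w]
    · rw [Category.assoc, Category.assoc, hl₂, hk₂, he₂]

/-- The fibre product in the Faltings site is formed componentwise. -/
noncomputable def fiberProd : FaltingsObj f :=
  ofIsPullback (V := pullback a.left b.left) (U := pullback a.right b.right)
    (toX := pullback.fst _ _ ≫ A.toX)
    (IsPullback.of_hasPullback (pullback.fst a.right b.right ≫ A.toX) f)
    (pullback.lift (pullback.map _ _ _ _ A.hom B.hom D.hom a.comm b.comm)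
      (pullback.fst _ _ ≫ A.toY)
      (by rw [pullback.map, pullback.lift_fst_assoc, Category.assoc, Category.assoc, A.w]))
    (by
      -- With `S` the fibre product of the bases, the morphism to `S ×_X Y` factors through `A.V
      -- ×_{A.U} S`: the first factor `e` is a base change of the finite étale `l`, the second
      -- factor `q` is a restriction of `A`.
      have hS := IsPullback.of_hasPullback a.right b.right
      have hT := IsPullback.of_hasPullback A.hom (pullback.fst a.right b.right)
      have hR := IsPullback.of_hasPullback D.hom b.right
      let m := pullback.map _ _ _ _ A.hom B.hom D.hom a.comm b.comm
      have hm₁ : m ≫ pullback.fst _ _ = pullback.fst _ _ ≫ A.hom := pullback.lift_fst _ _ _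
      have hm₂ : m ≫ pullback.snd _ _ = pullback.snd _ _ ≫ B.hom := pullback.lift_snd _ _ _
      let e := pullback.lift (f := A.hom) (g := pullback.fst a.right b.right)
        (pullback.fst a.left b.left) m hm₁.symm
      let k := pullback.lift (f := D.hom) (g := b.right)
        (pullback.fst A.hom (pullback.fst a.right b.right) ≫ a.left)
        (pullback.snd _ _ ≫ pullback.snd _ _) (by
          rw [Category.assoc, a.comm, hT.w_assoc, Category.assoc, hS.w])
      let l := pullback.lift (f := D.hom) (g := b.right) b.left B.hom b.comm
      have h := isPullback_lift_fiberProd a b (IsPullback.of_hasPullback _ _) hS hT hR (e := e)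
        (k := k) (l := l) (pullback.lift_fst _ _ _)
        (by rw [pullback.lift_snd_assoc, hm₂]) (pullback.lift_fst _ _ _)
        (pullback.lift_snd _ _ _) (pullback.lift_fst _ _ _) (pullback.lift_snd _ _ _)
      have hl : finiteEtale l := finiteEtale_of_isPullback b hR (pullback.lift_fst _ _ _)
        (pullback.lift_snd _ _ _)
      have he : finiteEtale e := MorphismProperty.of_isPullback h hl
      let q := pullback.lift (f := pullback.fst a.right b.right ≫ A.toX) (g := f)
        (pullback.snd A.hom (pullback.fst a.right b.right)) (pullback.fst _ _ ≫ A.toY) (by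
          rw [Category.assoc, ← A.w, hT.w_assoc])
      have hq : finiteEtale q := A.finiteEtale_restrict _ hT
        (IsPullback.of_hasPullback _ _) (pullback.lift_fst _ _ _) (pullback.lift_snd _ _ _)
      convert finiteEtale.comp_mem e q he hq using 1
      refine pullback.hom_ext ?_ ?_
      · rw [pullback.lift_fst, Category.assoc, pullback.lift_fst, pullback.lift_snd]
      · rw [pullback.lift_snd, Category.assoc, pullback.lift_snd, pullback.lift_fst_assoc])
    inferInstance _ _ (pullback.lift_fst _ _ _) (pullback.lift_snd _ _ _)

/-- The first projection. -/
noncomputable def fiberProdFst : fiberProd a b ⟶ A where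
  left := pullback.fst _ _
  right := pullback.fst _ _
  left_toY := rfl
  right_toX := rfl
  comm := (pullback.lift_fst _ _ _).symm

/-- The second projection. -/
noncomputable def fiberProdSnd : fiberProd a b ⟶ B where
  left := pullback.snd _ _
  right := pullback.snd _ _
  left_toY := by
    have : pullback.snd a.left b.left ≫ B.toY = pullback.fst a.left b.left ≫ A.toY := by
      rw [← b.left_toY, ← pullback.condition_assoc, a.left_toY]
    exact this
  right_toX := by
    have : pullback.snd a.right b.right ≫ B.toX = pullback.fst a.right b.right ≫ A.toX := by
      rw [← b.right_toX, ← pullback.condition_assoc, a.right_toX]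
    exact this
  comm := (pullback.lift_snd _ _ _).symm

lemma lift_comp_map {E : FaltingsObj f} (c : E ⟶ A) (d : E ⟶ B)
    (h₁ : c.left ≫ a.left = d.left ≫ b.left)
    (h₂ : c.right ≫ a.right = d.right ≫ b.right) :
    pullback.lift c.left d.left h₁ ≫ pullback.map _ _ _ _ A.hom B.hom D.hom a.comm b.comm =
      E.hom ≫ pullback.lift c.right d.right h₂ := by
  refine pullback.hom_ext ?_ ?_
  · rw [Category.assoc, Category.assoc, pullback.lift_fst, pullback.lift_fst_assoc,
      pullback.lift_fst, c.comm]
  · rw [Category.assoc, Category.assoc, pullback.lift_snd, pullback.lift_snd_assoc,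
      pullback.lift_snd, d.comm]

lemma isPullback_fiberProd : IsPullback (fiberProdFst a b) (fiberProdSnd a b) a b where
  w := hom_ext pullback.condition pullback.condition
  isLimit' := ⟨PullbackCone.IsLimit.mk _
    (fun s ↦
      { left := pullback.lift s.fst.left s.snd.left (congrArg Hom.left s.condition)
        right := pullback.lift s.fst.right s.snd.right (congrArg Hom.right s.condition)
        left_toY := (pullback.lift_fst_assoc _ _ _ _).trans s.fst.left_toY
        right_toX := (pullback.lift_fst_assoc _ _ _ _).trans s.fst.right_toX
        comm := lift_comp_map _ _ _ _ _ _ })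
    (fun _ ↦ hom_ext (pullback.lift_fst _ _ _) (pullback.lift_fst _ _ _))
    (fun _ ↦ hom_ext (pullback.lift_snd _ _ _) (pullback.lift_snd _ _ _))
    (fun _ _ h₁ h₂ ↦ hom_ext
      (pullback.hom_ext ((congrArg Hom.left h₁).trans (pullback.lift_fst _ _ _).symm)
        ((congrArg Hom.left h₂).trans (pullback.lift_snd _ _ _).symm))
      (pullback.hom_ext ((congrArg Hom.right h₁).trans (pullback.lift_fst _ _ _).symm)
        ((congrArg Hom.right h₂).trans (pullback.lift_snd _ _ _).symm)))⟩

instance : HasPullbacks (FaltingsObj f) :=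
  @hasPullbacks_of_hasLimit_cospan _ _ fun {_ _ _ a b} ↦ (isPullback_fiberProd a b).hasPullback

end Pullback

variable (f) in
/-- The terminal object of the Faltings site. -/
def terminal : FaltingsObj f :=
  ofIsPullback (V := Y) (U := X) (toX := 𝟙 X) (IsPullback.of_horiz_isIso ⟨by simp⟩ :
      IsPullback (𝟙 Y) f f (𝟙 X)).flip
    (𝟙 Y) (finiteEtale.id_mem Y) inferInstance f (𝟙 Y) (Category.id_comp _) (Category.id_comp _)

variable (f) in
/-- The object `(Y ⟶ X)` is terminal. -/
def isTerminalTerminal : IsTerminal (terminal f) :=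
  IsTerminal.ofUniqueHom
    (fun A ↦
      { left := A.toY
        right := A.toX
        left_toY := Category.comp_id _
        right_toX := Category.comp_id _
        comm := A.w.symm })
    fun _ m ↦ hom_ext ((Category.comp_id _).symm.trans m.left_toY)
      ((Category.comp_id _).symm.trans m.right_toX)

end FaltingsObj

/-! ### Coverings of coherent objects and the coherent basis. -/

namespace AlgebraicGeometry

lemma Scheme.ofArrows_mem_etalePrecoverage_iff {S : Scheme.{u}} {ι : Type*} {W : ι → Scheme.{u}}
    {h : ∀ i, W i ⟶ S} : Presieve.ofArrows W h ∈ Scheme.etalePrecoverage S ↔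
      (∀ x, ∃ i, x ∈ Set.range (h i)) ∧ ∀ i, Etale (h i) :=
  Scheme.ofArrows_mem_precoverage_iff _

/-- Étale morphisms are open, so their images form an open covering of a quasi-compact space. -/
lemma exists_finset_of_etale_cover {V : Scheme.{u}} [CompactSpace V] {ι : Type*}
    {W : ι → Scheme.{u}} (h : ∀ i, W i ⟶ V) [∀ i, Etale (h i)]
    (hs : ∀ x : V, ∃ i, x ∈ Set.range (h i)) :
    ∃ s : Finset ι, ∀ x : V, ∃ i ∈ s, x ∈ Set.range (h i) := by
  obtain ⟨s, hs⟩ := isCompact_univ.elim_finite_subcover (fun i ↦ Set.range (h i))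
    (fun i ↦ (h i).isOpenMap.isOpen_range) (fun x _ ↦ Set.mem_iUnion.2 (hs x))
  exact ⟨s, fun x ↦ by simpa using hs (Set.mem_univ x)⟩

end AlgebraicGeometry

namespace FaltingsObj

variable {X Y : Scheme.{u}} {f : Y ⟶ X}

section Covers

variable {A : FaltingsObj f} {ι : Type*} [Small.{u} ι] {B : ι → FaltingsObj f} (g : ∀ i, B i ⟶ A)

lemma ofArrows_mem_of_surjective_left (hg : ∀ i, IsIso (g i).right)
    (hs : ∀ x : A.V, ∃ i, x ∈ Set.range (g i).left) :
    Sieve.ofArrows B g ∈ faltingsTopology f A := by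
  let e := equivShrink.{u} ι
  have h : Sieve.ofArrows (fun i ↦ B (e.symm i)) (fun i ↦ g (e.symm i)) ∈ faltingsTopology f A := by
    refine Precoverage.generate_mem_toGrothendieck
      ⟨Shrink.{u} ι, _, _, rfl, .inl ⟨fun i ↦ hg _, ?_⟩⟩
    refine Scheme.ofArrows_mem_etalePrecoverage_iff.2 ⟨fun x ↦ ?_, fun i ↦ inferInstance⟩
    obtain ⟨i, hi⟩ := hs x
    obtain ⟨i, rfl⟩ := e.symm.surjective i
    exact ⟨i, hi⟩
  exact (faltingsTopology f).ofArrows_mem_of_comp e.symm h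

lemma ofArrows_mem_of_surjective_right
    (hg : ∀ i, IsPullback (g i).left (B i).hom A.hom (g i).right)
    (hs : ∀ x : A.U, ∃ i, x ∈ Set.range (g i).right) :
    Sieve.ofArrows B g ∈ faltingsTopology f A := by
  let e := equivShrink.{u} ι
  have h : Sieve.ofArrows (fun i ↦ B (e.symm i)) (fun i ↦ g (e.symm i)) ∈ faltingsTopology f A := by
    refine Precoverage.generate_mem_toGrothendieck
      ⟨Shrink.{u} ι, _, _, rfl, .inr ⟨?_, fun i ↦ hg _⟩⟩
    refine Scheme.ofArrows_mem_etalePrecoverage_iff.2 ⟨fun x ↦ ?_, fun i ↦ inferInstance⟩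
    obtain ⟨i, hi⟩ := hs x
    obtain ⟨i, rfl⟩ := e.symm.surjective i
    exact ⟨i, hi⟩
  exact (faltingsTopology f).ofArrows_mem_of_comp e.symm h

end Covers

lemma isCoh_iff (A : FaltingsObj f) : A.IsCoh ↔ QuasiCompact A.toX ∧ QuasiSeparated A.toX :=
  ⟨fun h ↦ h.2, fun h ↦ ⟨inferInstance, h⟩⟩

lemma isCoh_restrict [QuasiSeparatedSpace X] (A : FaltingsObj f) {W : Scheme.{u}} (h : W ⟶ A.U)
    [Etale h] [CompactSpace W] [QuasiSeparatedSpace W] : (A.restrict h).IsCoh := by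
  have h₁ : QuasiCompact (h ≫ A.toX) := inferInstance
  have h₂ : QuasiSeparated (h ≫ A.toX) := inferInstance
  exact (isCoh_iff _).2 ⟨h₁, h₂⟩

/-- By cancellation over `X`, `b.right` is quasi-compact and quasi-separated, hence so is its base
change to `A.U`. -/
lemma isCoh_fiberProd {A B D : FaltingsObj f} (hA : A.IsCoh) (hB : B.IsCoh) (hD : D.IsCoh)
    (a : A ⟶ D) (b : B ⟶ D) : (fiberProd a b).IsCoh := by
  obtain ⟨-, _, _⟩ := hA
  obtain ⟨-, hB₁, hB₂⟩ := hB
  obtain ⟨-, _, _⟩ := hD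
  rw [← b.right_toX] at hB₁ hB₂
  have := QuasiCompact.of_comp b.right D.toX
  have := QuasiSeparated.of_comp b.right D.toX
  have h₁ : QuasiCompact (pullback.fst a.right b.right ≫ A.toX) := inferInstance
  have h₂ : QuasiSeparated (pullback.fst a.right b.right ≫ A.toX) := inferInstance
  exact (isCoh_iff _).2 ⟨h₁, h₂⟩

lemma isCoh_terminal : (terminal f).IsCoh := by
  have h₁ : QuasiCompact (𝟙 X) := inferInstance
  have h₂ : QuasiSeparated (𝟙 X) := inferInstance
  exact (isCoh_iff _).2 ⟨h₁, h₂⟩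

lemma IsCoh.of_isIso_right {A B : FaltingsObj f} (hA : A.IsCoh) (g : B ⟶ A) [IsIso g.right] :
    B.IsCoh := by
  obtain ⟨-, _, _⟩ := hA
  rw [isCoh_iff, ← g.right_toX]
  exact ⟨inferInstance, inferInstance⟩

lemma IsCoh.compactSpace_U [CompactSpace X] {A : FaltingsObj f} (hA : A.IsCoh) :
    CompactSpace A.U :=
  have := hA.2.1
  QuasiCompact.compactSpace_of_compactSpace A.toX

/-- `V` is finite over `U ×_X Y`, which is quasi-compact over `Y` by base change. -/
lemma IsCoh.compactSpace_V [CompactSpace Y] {A : FaltingsObj f} (hA : A.IsCoh) :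
    CompactSpace A.V := by
  have := hA.2.1
  have := A.finite_lift
  have : CompactSpace ↥(pullback A.toX f) :=
    QuasiCompact.compactSpace_of_compactSpace (pullback.snd A.toX f)
  exact QuasiCompact.compactSpace_of_compactSpace (pullback.lift A.hom A.toY A.w)

lemma exists_affine_cover [QuasiSeparatedSpace X] (A : FaltingsObj f) :
    ∃ (ι : Type u) (Z : ι → FaltingsObj f) (g : ∀ i, Z i ⟶ A), (∀ i, (Z i).IsCoh) ∧
      Sieve.ofArrows Z g ∈ faltingsTopology f A := by
  refine ⟨A.U.affineCover.I₀, fun i ↦ A.restrict (A.U.affineCover.f i),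
    fun i ↦ A.restrictHom (A.U.affineCover.f i), fun i ↦ A.isCoh_restrict _,
    ofArrows_mem_of_surjective_right _ (fun i ↦ A.isPullback_restrictHom _) fun x ↦ ?_⟩
  exact ⟨_, A.U.affineCover.covers x⟩

/-- The pulled-back covering of `E` is again vertical. Its members share the base of `E`, so they
stay coherent, and finitely many cover the quasi-compact `E.V`. -/
lemma hasFiniteRefinement_of_isVerticalCover [CompactSpace Y] {A : FaltingsObj f} {ι : Type u}
    {B : ι → FaltingsObj f} {g : ∀ i, B i ⟶ A} (hg : A.IsVerticalCover B g) {E : FaltingsObj f}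
    (hE : E.IsCoh) (a : E ⟶ A) :
    ((Sieve.generate (Presieve.ofArrows B g)).pullback a).HasFiniteRefinement
      (faltingsTopology f) IsCoh := by
  obtain ⟨hg, hs⟩ := hg
  rw [Scheme.ofArrows_mem_etalePrecoverage_iff] at hs
  have := hE.compactSpace_V
  have hi (i) : IsIso (fiberProdFst a (g i)).right := by
    exact inferInstanceAs (IsIso (pullback.fst a.right (g i).right))
  obtain ⟨s, hs'⟩ := exists_finset_of_etale_cover (fun i ↦ (fiberProdFst a (g i)).left) fun x ↦ by
    obtain ⟨i, y, hy⟩ := hs.1 (a.left x)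
    obtain ⟨z, hz, -⟩ := Scheme.Pullback.exists_preimage_pullback x y hy.symm
    exact ⟨i, z, hz⟩
  refine .mk (fun i : s ↦ fiberProd a (g i)) (fun i ↦ fiberProdFst a (g i))
    (fun i ↦ hE.of_isIso_right (fiberProdFst a (g i))) (fun i ↦ ?_)
    (ofArrows_mem_of_surjective_left _ (fun i ↦ hi i) fun x ↦ ?_)
  · exact ⟨_, fiberProdSnd a (g i), g i, ⟨i.1⟩, (isPullback_fiberProd a (g i)).w.symm⟩
  · obtain ⟨i, hi, hx⟩ := hs' x
    exact ⟨⟨i, hi⟩, hx⟩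

/-- A morphism to `A` whose second component factors through the second component of a cartesian
morphism `g : B ⟶ A` factors through `g`. -/
lemma exists_fac_of_isPullback {A B E : FaltingsObj f} (g : B ⟶ A)
    (hg : IsPullback g.left B.hom A.hom g.right) (a : E ⟶ A) (k : E.U ⟶ B.U)
    (hk : k ≫ g.right = a.right) : ∃ b : E ⟶ B, b ≫ g = a := by
  let l := hg.lift a.left (E.hom ≫ k) (by rw [a.comm, Category.assoc, hk])
  refine ⟨⟨l, k, ?_, ?_, hg.lift_snd _ _ _⟩, hom_ext (hg.lift_fst _ _ _) hk⟩
  · rw [← g.left_toY, hg.lift_fst_assoc, a.left_toY]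
  · rw [← g.right_toX, reassoc_of% hk, a.right_toX]

/-- The fibre products `E.U ×_U U_i` need not be quasi-compact, so they are first cut into affine
opens; finitely many of these cover `E.U`, and `E` is restricted to them. -/
lemma hasFiniteRefinement_of_isCartesianCover [CompactSpace X] [QuasiSeparatedSpace X]
    {A : FaltingsObj f} {ι : Type u} {B : ι → FaltingsObj f} {g : ∀ i, B i ⟶ A}
    (hg : A.IsCartesianCover B g) {E : FaltingsObj f} (hE : E.IsCoh) (a : E ⟶ A) :
    ((Sieve.generate (Presieve.ofArrows B g)).pullback a).HasFiniteRefinement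
      (faltingsTopology f) IsCoh := by
  obtain ⟨hs, hg⟩ := hg
  rw [Scheme.ofArrows_mem_etalePrecoverage_iff] at hs
  have := hE.compactSpace_U
  let 𝒰 (i : ι) := (pullback a.right (g i).right).affineCover
  let h (j : Σ i, (𝒰 i).I₀) : (𝒰 j.1).X j.2 ⟶ E.U := (𝒰 j.1).f j.2 ≫ pullback.fst _ _
  obtain ⟨s, hs'⟩ := exists_finset_of_etale_cover h fun x ↦ by
    obtain ⟨i, y, hy⟩ := hs.1 (a.right x)
    obtain ⟨z, rfl, -⟩ := Scheme.Pullback.exists_preimage_pullback x y hy.symm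
    obtain ⟨t, ht⟩ := (𝒰 i).covers z
    exact ⟨⟨i, _⟩, t, (Scheme.Hom.comp_apply _ _ _).trans (congrArg _ ht)⟩
  refine .mk (fun j : s ↦ E.restrict (h j)) (fun j ↦ E.restrictHom (h j))
    (fun j ↦ ?_) (fun j ↦ ?_)
    (ofArrows_mem_of_surjective_right _ (fun j ↦ E.isPullback_restrictHom _) fun x ↦ ?_)
  · have : IsAffine ((𝒰 j.1.1).X j.1.2) := inferInstanceAs (IsAffine (Spec _))
    exact E.isCoh_restrict _
  -- Membership in the sieve needs a factorization of the base component only, because `g` is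
  -- cartesian.
  · obtain ⟨b, hb⟩ := exists_fac_of_isPullback (g j.1.1) (hg j.1.1)
      (E.restrictHom (h j) ≫ a) ((𝒰 j.1.1).f j.1.2 ≫ pullback.snd _ _) (by
        have : ((𝒰 j.1.1).f j.1.2 ≫ pullback.snd a.right (g j.1.1).right) ≫ (g j.1.1).right =
            h j ≫ a.right := by
          rw [Category.assoc, ← pullback.condition, Category.assoc]
        exact this)
    exact ⟨_, b, _, ⟨j.1.1⟩, hb⟩
  · obtain ⟨j, hj, hx⟩ := hs' x
    exact ⟨⟨j, hj⟩, hx⟩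

variable (f) in
/-- The coherent objects form a coherent basis of the Faltings site. -/
theorem isCoherentBasis_isCoh [CompactSpace X] [QuasiSeparatedSpace X] [CompactSpace Y] :
    (faltingsTopology f).IsCoherentBasis IsCoh where
  dense A := by
    obtain ⟨ι, Z, g, hZ, hg⟩ := A.exists_affine_cover
    refine ⟨_, hg, ?_⟩
    rintro V _ ⟨_, h, _, ⟨i⟩, rfl⟩
    exact ⟨Z i, hZ i, h, g i, rfl⟩
  finite B hB S hS := by
    have := Precoverage.hasFiniteRefinement_of_mem (faltingsPrecoverage f) IsCoh ?_ S hS hB (𝟙 B)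
    · rw [Sieve.pullback_id] at this
      exact this.exists_fin
    · rintro A _ ⟨ι, B, g, rfl, hg | hg⟩ E hE a
      · exact hasFiniteRefinement_of_isVerticalCover hg hE a
      · exact hasFiniteRefinement_of_isCartesianCover hg hE a
  pullback A B D hA hB hD a b :=
    ⟨fiberProd a b, fiberProdFst a b, fiberProdSnd a b, isCoh_fiberProd hA hB hD a b,
      isPullback_fiberProd a b⟩
  terminal := ⟨terminal f, isTerminalTerminal f, isCoh_terminal⟩

end FaltingsObj

/-! ### Essential smallness. -/

namespace CategoryTheory.ObjectProperty

/-- A property of objects is essentially small if its objects are classified up to isomorphism by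
a relation to a small set. -/
lemma EssentiallySmall.of_relation {C : Type*} [Category* C] (P : ObjectProperty C) {κ : Type*}
    [Small.{w} κ] (R : C → κ → Prop) (h : ∀ A, P A → ∃ k, R A k)
    (h' : ∀ A B k, R A k → R B k → Nonempty (A ≅ B)) : ObjectProperty.EssentiallySmall.{w} P where
  exists_small_le' := by
    refine ⟨ofObj fun k : {k // ∃ A, R A k} ↦ k.2.choose, inferInstance, fun A hA ↦ ?_⟩
    obtain ⟨k, hk⟩ := h A hA
    exact ⟨_, ⟨⟨k, A, hk⟩⟩, h' _ _ k hk (⟨A, hk⟩ : ∃ A, R A k).choose_spec⟩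

/-- An essentially small property is dominated by a small family. -/
lemma EssentiallySmall.exists_family {C : Type*} [Category* C] (P : ObjectProperty C)
    [ObjectProperty.EssentiallySmall.{w} P] :
    ∃ (ι : Type w) (S : ι → C), ∀ A, P A → ∃ i, Nonempty (A ≅ S i) := by
  obtain ⟨Q, _, hQ⟩ := EssentiallySmall.exists_small_le'.{w} P
  refine ⟨Shrink.{w} (Subtype Q), fun i ↦ ((equivShrink _).symm i).1, fun A hA ↦ ?_⟩
  obtain ⟨B, hB, ⟨e⟩⟩ := hQ A hA
  exact ⟨equivShrink _ ⟨B, hB⟩, ⟨e ≪≫ eqToIso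
    (congrArg Subtype.val ((equivShrink (Subtype Q)).symm_apply_apply ⟨B, hB⟩)).symm⟩⟩

end CategoryTheory.ObjectProperty

namespace AlgebraicGeometry.Scheme

/-- The class of étale morphisms. -/
def etaleMorphisms : MorphismProperty Scheme.{u} := @Etale

instance : HasRingHomProperty etaleMorphisms.{u} RingHom.Etale :=
  inferInstanceAs (HasRingHomProperty @Etale.{u} _)

/-- The class of morphisms locally of finite type. -/
def finiteTypeMorphisms : MorphismProperty Scheme.{u} := @LocallyOfFiniteType

instance : HasRingHomProperty finiteTypeMorphisms.{u} RingHom.FiniteType :=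
  inferInstanceAs (HasRingHomProperty @LocallyOfFiniteType.{u} _)

/-- A finite disjoint union of affine opens is affine. -/
lemma exists_etale_surjective_of_compactSpace (W : Scheme.{u}) [CompactSpace W] :
    ∃ (R : CommRingCat.{u}) (p : Spec R ⟶ W), Etale p ∧ Surjective p := by
  let 𝒰 : W.OpenCover := W.affineCover.finiteSubcover
  have h₁ : Etale (Sigma.desc 𝒰.f) := IsZariskiLocalAtSource.sigmaDesc (P := etaleMorphisms)
    fun i ↦ inferInstanceAs (Etale (𝒰.f i))
  exact ⟨Γ(∐ 𝒰.X, ⊤), (∐ 𝒰.X).isoSpec.inv ≫ Sigma.desc 𝒰.f, inferInstance, inferInstance⟩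

variable (Z : Scheme.{u})

/-- The affine schemes locally of finite type over `Z`. -/
def affineOfFiniteType : ObjectProperty (Over Z) :=
  fun W ↦ IsAffine W.left ∧ LocallyOfFiniteType W.hom

instance : ObjectProperty.EssentiallySmall.{u} (affineOfFiniteType Z) := by
  let 𝒞 := MorphismProperty.CostructuredArrow finiteTypeMorphisms ⊤ Scheme.Spec.{u} Z
  have : EssentiallySmall.{u} 𝒞 := essentiallySmall_costructuredArrow_Spec _ le_rfl
  let F : 𝒞 ⥤ Over Z :=
    MorphismProperty.CostructuredArrow.toOver finiteTypeMorphisms Scheme.Spec.{u} Z ⋙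
    MorphismProperty.Over.forget finiteTypeMorphisms ⊤ Z
  refine ⟨ObjectProperty.ofObj fun c : SmallModel.{u} 𝒞 ↦ F.obj ((equivSmallModel 𝒞).inverse.obj c),
    inferInstance, fun W hW ↦ ?_⟩
  obtain ⟨_, hW⟩ := hW
  let g : Spec Γ(W.left, ⊤) ⟶ Z := W.left.isoSpec.inv ≫ W.hom
  have hg : LocallyOfFiniteType g := inferInstance
  let o : 𝒞 := MorphismProperty.CostructuredArrow.mk ⊤ (A := op Γ(W.left, ⊤)) g hg
  have e : W ≅ F.obj o := Over.isoMk W.left.isoSpec (by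
    change W.left.isoSpec.hom ≫ W.left.isoSpec.inv ≫ W.hom = _
    simp)
  exact ⟨_, ⟨(equivSmallModel 𝒞).functor.obj o⟩,
    ⟨e ≪≫ F.mapIso ((equivSmallModel 𝒞).unitIso.app o)⟩⟩

/-- The quasi-compact quasi-separated schemes locally of finite type over `Z`. -/
def coherentOfFiniteType : ObjectProperty (Over Z) :=
  fun W ↦ CompactSpace W.left ∧ QuasiSeparatedSpace W.left ∧ LocallyOfFiniteType W.hom

variable {Z} in
/-- `W` is a coequalizer of the pair `(a, b)`. -/
def IsCoequalizer {U V : Over Z} (W : Over Z) (a b : U ⟶ V) : Prop :=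
  ∃ (p : V ⟶ W) (h : a ≫ p = b ≫ p), Nonempty (IsColimit (Cofork.ofπ p h))

variable {Z} in
-- Take an affine étale surjection `V ⟶ W`, which is an effective epimorphism. Quasi-separatedness
-- makes `V ×_W V` quasi-compact, so it too receives an étale surjection from an affine `U`.
lemma coherentOfFiniteType.exists_presentation {W : Over Z} (hW : coherentOfFiniteType Z W) :
    ∃ (U V : Over Z) (a b : U ⟶ V), affineOfFiniteType Z U ∧ affineOfFiniteType Z V ∧
      IsCoequalizer W a b := by
  obtain ⟨_, _, _⟩ := hW
  obtain ⟨R, p, _, _⟩ := W.left.exists_etale_surjective_of_compactSpace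
  have : CompactSpace ↥(pullback p p) :=
    QuasiCompact.compactSpace_of_compactSpace (pullback.fst p p)
  obtain ⟨R', q, _, _⟩ := (pullback p p).exists_etale_surjective_of_compactSpace
  -- This lets `U` replace the kernel pair without changing the coequalizer.
  have : Epi q := Flat.epi_of_flat_of_surjective q
  let V : Over Z := Over.mk (p ≫ W.hom)
  let U : Over Z := Over.mk (q ≫ pullback.fst p p ≫ p ≫ W.hom)
  let π : V ⟶ W := Over.homMk p
  let a : U ⟶ V := Over.homMk (q ≫ pullback.fst p p) (Category.assoc _ _ _)
  let b : U ⟶ V := Over.homMk (q ≫ pullback.snd p p) (by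
    change (q ≫ pullback.snd p p) ≫ p ≫ W.hom = q ≫ pullback.fst p p ≫ p ≫ W.hom
    rw [Category.assoc, pullback.condition_assoc])
  have w : a ≫ π = b ≫ π := by
    ext1
    change (q ≫ pullback.fst p p) ≫ p = (q ≫ pullback.snd p p) ≫ p
    rw [Category.assoc, Category.assoc, pullback.condition]
  refine ⟨U, V, a, b, ⟨inferInstanceAs (IsAffine (Spec _)), ?_⟩,
    ⟨inferInstanceAs (IsAffine (Spec _)), ?_⟩, π, w, ⟨?_⟩⟩
  · exact inferInstanceAs (LocallyOfFiniteType (q ≫ pullback.fst p p ≫ p ≫ W.hom))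
  · exact inferInstanceAs (LocallyOfFiniteType (p ≫ W.hom))
  · refine Cofork.IsColimit.mk' _ fun s ↦ ?_
    have hs : pullback.fst p p ≫ s.π.left = pullback.snd p p ≫ s.π.left := by
      rw [← cancel_epi q]
      have := congrArg CommaMorphism.left s.condition
      exact (Category.assoc _ _ _).symm.trans (this.trans (Category.assoc _ _ _))
    have hd {T : Scheme.{u}} (g₁ g₂ : T ⟶ Spec R) (hg : g₁ ≫ p = g₂ ≫ p) :
        g₁ ≫ s.π.left = g₂ ≫ s.π.left := by
      rw [← pullback.lift_fst g₁ g₂ hg, Category.assoc, hs, pullback.lift_snd_assoc]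
    let d : W.left ⟶ s.pt.left := EffectiveEpi.desc p s.π.left hd
    have hpd : p ≫ d = s.π.left := EffectiveEpi.fac _ _ _
    refine ⟨Over.homMk d ?_, ?_, fun {m} hm ↦ ?_⟩
    · rw [← cancel_epi p, reassoc_of% hpd]
      exact Over.w s.π
    · ext1
      exact hpd
    · ext1
      rw [← cancel_epi p]
      exact (congrArg CommaMorphism.left hm).trans hpd.symm

/-- Parallel pairs within a small family of affine schemes form a small set, and a pair determines
its coequalizer up to isomorphism. -/
instance : ObjectProperty.EssentiallySmall.{u} (coherentOfFiniteType Z) := by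
  obtain ⟨ι, S, hS⟩ := ObjectProperty.EssentiallySmall.exists_family.{u} (affineOfFiniteType Z)
  refine .of_relation (κ := Σ (i j : ι), (S i ⟶ S j) × (S i ⟶ S j)) _
    (fun W k ↦ IsCoequalizer W k.2.2.1 k.2.2.2) (fun W hW ↦ ?_) fun W W' k h h' ↦ ?_
  · obtain ⟨U, V, a, b, hU, hV, p, w, ⟨hc⟩⟩ := hW.exists_presentation
    obtain ⟨i, ⟨eU⟩⟩ := hS U hU
    obtain ⟨j, ⟨eV⟩⟩ := hS V hV
    refine ⟨⟨i, j, eU.inv ≫ a ≫ eV.hom, eU.inv ≫ b ≫ eV.hom⟩, eV.inv ≫ p, ?_, ⟨?_⟩⟩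
    · simp [w]
    · refine Cofork.IsColimit.mk' _ fun s ↦ ?_
      obtain ⟨l, hl⟩ := Cofork.IsColimit.desc' hc (eV.hom ≫ s.π) (by
        have := s.condition
        simp only [Category.assoc, Iso.cancel_iso_inv_left] at this
        exact this)
      refine ⟨l, ?_, fun {m} hm ↦ ?_⟩
      · have : p ≫ l = eV.hom ≫ s.π := hl
        change (eV.inv ≫ p) ≫ l = _
        rw [Category.assoc, this, Iso.inv_hom_id_assoc]
      · refine Cofork.IsColimit.hom_ext hc ?_
        change p ≫ m = p ≫ l
        have hm' : (eV.inv ≫ p) ≫ m = s.π := hm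
        have : p ≫ l = eV.hom ≫ s.π := hl
        rw [this, ← hm', Category.assoc, Iso.hom_inv_id_assoc]
  · obtain ⟨p, w, ⟨hc⟩⟩ := h
    obtain ⟨p', w', ⟨hc'⟩⟩ := h'
    exact ⟨hc.coconePointUniqueUpToIso hc'⟩

end AlgebraicGeometry.Scheme

/-! ### Smallness of the coherent objects and the conclusion. -/

namespace FaltingsObj

variable {X Y : Scheme.{u}} {f : Y ⟶ X}

lemma IsCoh.coherentOfFiniteType_toX [CompactSpace X] [QuasiSeparatedSpace X] {A : FaltingsObj f}
    (hA : A.IsCoh) : Scheme.coherentOfFiniteType X (Over.mk A.toX) := by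
  have := hA.2.2
  exact ⟨hA.compactSpace_U, quasiSeparatedSpace_of_quasiSeparated A.toX,
    inferInstanceAs (LocallyOfFiniteType A.toX)⟩

lemma IsCoh.coherentOfFiniteType_toY [CompactSpace Y] [QuasiSeparatedSpace Y] {A : FaltingsObj f}
    (hA : A.IsCoh) : Scheme.coherentOfFiniteType Y (Over.mk A.toY) := by
  have := hA.2.2
  have := A.finite_lift
  have : QuasiSeparated A.toY := by
    rw [← pullback.lift_snd A.hom A.toY A.w]
    infer_instance
  exact ⟨hA.compactSpace_V, quasiSeparatedSpace_of_quasiSeparated A.toY,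
    inferInstanceAs (LocallyOfFiniteType A.toY)⟩

lemma nonempty_iso {A B : FaltingsObj f} (eU : Over.mk A.toX ≅ Over.mk B.toX)
    (eV : Over.mk A.toY ≅ Over.mk B.toY) (h : eV.hom.left ≫ B.hom = A.hom ≫ eU.hom.left) :
    Nonempty (A ≅ B) :=
  let u : A.U ≅ B.U := (Over.forget X).mapIso eU
  let v : A.V ≅ B.V := (Over.forget Y).mapIso eV
  have h' : v.inv ≫ A.hom = B.hom ≫ u.inv := by
    rw [Iso.inv_comp_eq, ← Category.assoc, Iso.eq_comp_inv]
    exact h.symm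
  ⟨{  hom := ⟨v.hom, u.hom, Over.w eV.hom, Over.w eU.hom, h⟩
      inv := ⟨v.inv, u.inv, Over.w eV.inv, Over.w eU.inv, h'⟩
      hom_inv_id := hom_ext v.hom_inv_id u.hom_inv_id
      inv_hom_id := hom_ext v.inv_hom_id u.inv_hom_id }⟩

/-- Up to isomorphism, an object is given by `U` over `X`, `V` over `Y` and a morphism `V ⟶ U`, with
`U` and `V` ranging over small families. -/
instance [CompactSpace X] [QuasiSeparatedSpace X] [CompactSpace Y] [QuasiSeparatedSpace Y] :
    ObjectProperty.EssentiallySmall.{u} (IsCoh (f := f)) := by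
  obtain ⟨ι, S, hS⟩ :=
    ObjectProperty.EssentiallySmall.exists_family.{u} (Scheme.coherentOfFiniteType X)
  obtain ⟨κ, T, hT⟩ :=
    ObjectProperty.EssentiallySmall.exists_family.{u} (Scheme.coherentOfFiniteType Y)
  refine .of_relation (κ := Σ (i : ι) (j : κ), ((T j).left ⟶ (S i).left)) _
    (fun A k ↦ ∃ (eU : Over.mk A.toX ≅ S k.1) (eV : Over.mk A.toY ≅ T k.2.1),
      eV.hom.left ≫ k.2.2 = A.hom ≫ eU.hom.left) (fun A hA ↦ ?_) ?_
  · obtain ⟨i, ⟨eU⟩⟩ := hS _ hA.coherentOfFiniteType_toX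
    obtain ⟨j, ⟨eV⟩⟩ := hT _ hA.coherentOfFiniteType_toY
    refine ⟨⟨i, j, eV.inv.left ≫ A.hom ≫ eU.hom.left⟩, eU, eV, ?_⟩
    have : eV.hom.left ≫ eV.inv.left = 𝟙 _ := congrArg CommaMorphism.left eV.hom_inv_id
    exact (reassoc_of% this) _
  · rintro A B ⟨i, j, m⟩ ⟨eU, eV, h⟩ ⟨eU', eV', h'⟩
    refine nonempty_iso (eU ≪≫ eU'.symm) (eV ≪≫ eV'.symm) ?_
    let u' : B.U ≅ (S i).left := (Over.forget X).mapIso eU'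
    let v' : B.V ≅ (T j).left := (Over.forget Y).mapIso eV'
    change (eV.hom.left ≫ v'.inv) ≫ B.hom = A.hom ≫ eU.hom.left ≫ u'.inv
    have h' : v'.hom ≫ m = B.hom ≫ u'.hom := h'
    have h'' : v'.inv ≫ B.hom = m ≫ u'.inv := by
      rw [Iso.inv_comp_eq, ← Category.assoc, h', Category.assoc, Iso.hom_inv_id, Category.comp_id]
    rw [Category.assoc, h'', reassoc_of% h]

end FaltingsObj

theorem proposition10p4 {X Y : Scheme.{u}} (f : Y ⟶ X)
    [CompactSpace X] [QuasiSeparatedSpace X] [CompactSpace Y] [QuasiSeparatedSpace Y] :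
    ∃ _ : HasSheafify (faltingsTopology f) (Type u),
      (∀ A : FaltingsObj f, A.IsCoh →
        ToposCoherence.IsCoherentObj
          ((presheafToSheaf (faltingsTopology f) (Type u)).obj (yoneda.obj A))) ∧
      ToposCoherence.IsCoherentTopos (FaltingsTopos f) ∧
      GrothendieckTopology.HasEnoughPoints.{u} (faltingsTopology f) := by
  have h := FaltingsObj.isCoherentBasis_isCoh f
  obtain ⟨h₁, h₂, h₃⟩ := h.hasEnoughPoints FaltingsObj.exists_affine_cover
  exact ⟨h₁, fun A hA ↦ ToposCoherence.isCoherentObj_sheafify_yoneda h hA,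
    ToposCoherence.isCoherentTopos_of_isCoherentBasis h, h₃⟩
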